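/- Let $n\ge 2$ be even and let $\sigma_j^x,\sigma_j^y,\sigma_j^z$ be the Pauli operators on the $j$-th qubit of $(\mathbb C^2)^{\otimes n}$. For real $J,h$ consider the XX chain with open boundaries $$H(h)=\sum_{j=1}^{n-1}J\,(\sigma_j^x\sigma_{j+1}^x+\sigma_j^y\sigma_{j+1}^y)+h\,S_z,\qquad S_z=\sum_{j=1}^n\sigma_j^z .$$ A ground state of $H(h)$ is a unit eigenvector for the least eigenvalue. The $n$-concurrence of a unit vector $\psi$ is $C_n(\psi)=|\langle\psi|\Theta\psi\rangle|$, where $\Theta=\big[\prod_{j=1}^n(-i\sigma_j^y)\big]\tau$ and $\tau$ is complex conjugation in the computational basis. Put $h_{\rm crit}=2J\sin\!\big(\frac{\pi}{2(n+1)}\big)$. (1) If $J\ge 0$, the least eigenvalue of $H(0)$ is $$E_0=-4J\sum_{k=1}^{n/2}\cos\frac{\pi k}{n+1}=-4J\left(\frac{\cos\big(\frac{n\pi}{4(n+1)}\big)\sin\big(\frac{(n+2)\pi}{4(n+1)}\big)}{\sin\big(\frac{\pi}{2(n+1)}\big)}-1\right).$$ (2) Let $J>0$. (a) The least eigenvalue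 of $H(0)$ is non-degenerate, and its ground state satisfies $S_z\psi=0$. (b) If $|h|<h_{\rm crit}$, the least eigenvalue of $H(h)$ is non-degenerate, and every ground state of $H(h)$ is also a ground state of $H(0)$, has $S_z\psi=0$, and has $C_n(\psi)=1$. (c) If $|h|=h_{\rm crit}$, the least eigenvalue of $H(h)$ is exactly doubly degenerate: the ground states of $H(0)$ are still ground states of $H(h)$, and there is also a ground state $\varphi$ of $H(h)$ with $S_z\varphi=-2\,\mathrm{sgn}(h)\,\varphi$ and $C_n(\varphi)=0$. (d) If $|h|\ge h_{\rm crit}$, then $H(h)$ has a ground state that is an eigenvector of $S_z$ with nonzero eigenvalue, and every such ground state has $C_n=0$. (e) If $|h|>h_{\rm crit}$, then every ground state $\psi$ of $H(h)$ has $C_n(\psi)=0$, and none satisfies $S_z\psi=0$. (3) For all real $J$, $h$ and $\beta$, the partition function is $$Z(h)=\operatorname{Tr}e^{-\beta H(h)}=2^n\prod_{k=1}^n\cosh\!\Big(\beta\Big(h+2J\cos\frac{\pi k}{n+1}\Big)\Big).$$ -/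

import Mathlib

open scoped Matrix

namespace XXChain

noncomputable section

/-- Computational basis configurations of `n` qubits; the value `0` is spin up (`σᶻ = 1`) and the
value `1` is spin down (`σᶻ = -1`). -/
abbrev Config (n : ℕ) : Type := Fin n → Fin 2

/-- The Hilbert space `(ℂ²)^{⊗ n}` of `n` qubits. -/
abbrev Qubits (n : ℕ) : Type := EuclideanSpace ℂ (Config n)

/-- Operators on `n` qubits, as matrices in the computational basis. -/
abbrev Op (n : ℕ) : Type := Matrix (Config n) (Config n) ℂ

/-- The Pauli matrix `σˣ`. -/
def pauliX : Matrix (Fin 2) (Fin 2) ℂ := !![0, 1; 1, 0]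

/-- The Pauli matrix `σʸ`. -/
def pauliY : Matrix (Fin 2) (Fin 2) ℂ := !![0, -Complex.I; Complex.I, 0]

/-- The Pauli matrix `σᶻ`. -/
def pauliZ : Matrix (Fin 2) (Fin 2) ℂ := !![1, 0; 0, -1]

/-- The tensor product `A₁ ⊗ ⋯ ⊗ Aₙ` of one-qubit operators. -/
def tensorOp {n : ℕ} (A : Fin n → Matrix (Fin 2) (Fin 2) ℂ) : Op n :=
  Matrix.of fun s t => ∏ j, A j (s j) (t j)

/-- The operator `A` acting on the qubit `j` and the identity acting on all others. -/
def siteOp {n : ℕ} (A : Matrix (Fin 2) (Fin 2) ℂ) (j : Fin n) : Op n :=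
  tensorOp (Pi.mulSingle j A)

/-- The collective spin operator `S_z = ∑ⱼ σⱼᶻ`. -/
def spinZ (n : ℕ) : Op n := ∑ j : Fin n, siteOp pauliZ j

/-- The XX Hamiltonian with open boundaries,
`H(h) = ∑_{j=1}^{n-1} J (σⱼˣ σⱼ₊₁ˣ + σⱼʸ σⱼ₊₁ʸ) + h ∑_{j=1}^{n} σⱼᶻ`. -/
def hamiltonian (n : ℕ) (J h : ℝ) : Op n :=
  (∑ j : Fin (n - 1), (J : ℂ) •
      (siteOp pauliX (⟨j, by omega⟩ : Fin n) * siteOp pauliX (⟨j + 1, by omega⟩ : Fin n) +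
        siteOp pauliY (⟨j, by omega⟩ : Fin n) * siteOp pauliY (⟨j + 1, by omega⟩ : Fin n))) +
    (h : ℂ) • spinZ n

/-- The (real) eigenvalues of an operator. -/
def energies {n : ℕ} (H : Op n) : Set ℝ :=
  {E | Module.End.HasEigenvalue (Matrix.toEuclideanLin H) (E : ℂ)}

/-- `E` is the ground state energy of `H`: the least eigenvalue. -/
def IsGroundEnergy {n : ℕ} (H : Op n) (E : ℝ) : Prop := IsLeast (energies H) E

/-- `ψ` is a (normalized) ground state of `H`. -/
def IsGroundState {n : ℕ} (H : Op n) (ψ : Qubits n) : Prop :=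
  ‖ψ‖ = 1 ∧ ∃ E : ℝ, IsGroundEnergy H E ∧ Matrix.toEuclideanLin H ψ = (E : ℂ) • ψ

/-- The degeneracy of the ground state energy of `H` is `d`: the eigenspace of the least eigenvalue
has dimension `d`. -/
def HasGroundDegeneracy {n : ℕ} (H : Op n) (d : ℕ) : Prop :=
  ∃ E : ℝ, IsGroundEnergy H E ∧
    Module.finrank ℂ (Module.End.eigenspace (Matrix.toEuclideanLin H) (E : ℂ)) = d

/-- `ψ` satisfies `S_z ψ = s ψ`. -/
def HasSpinZ {n : ℕ} (ψ : Qubits n) (s : ℝ) : Prop :=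
  Matrix.toEuclideanLin (spinZ n) ψ = (s : ℂ) • ψ

/-- The anti-unitary time reversal `[∏ⱼ (-i σⱼʸ)] τ`, where `τ` is complex conjugation in the
computational basis. -/
def timeReversal {n : ℕ} (ψ : Qubits n) : Qubits n :=
  Matrix.toEuclideanLin (tensorOp fun _ : Fin n => (-Complex.I) • pauliY)
    (WithLp.toLp 2 fun s => (starRingEnd ℂ) (ψ s))

/-- The `n`-concurrence of a pure state, `Cₙ(ψ) = |⟨ψ| Θ |ψ⟩|` with `Θ` the time reversal. -/
def concurrence {n : ℕ} (ψ : Qubits n) : ℝ := ‖inner ℂ ψ (timeReversal ψ)‖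

/-- The partition function `Tr exp(-β H)`. -/
def partitionFunction {n : ℕ} (H : Op n) (β : ℝ) : ℂ :=
  (NormedSpace.exp ((-(β : ℂ)) • H)).trace

/-- The critical field `2 J sin(π / (2 (n + 1)))` of the open chain. -/
def hCrit (n : ℕ) (J : ℝ) : ℝ := 2 * J * Real.sin (Real.pi / (2 * ((n : ℝ) + 1)))

end

end XXChain

/-!
The chain is a gas of free fermions. The Jordan–Wigner strings `σ₁ᶻ ⋯ σⱼ₋₁ᶻ σⱼˣ` and
`σ₁ᶻ ⋯ σⱼ₋₁ᶻ σⱼʸ` satisfy the Clifford relations, and the Hamiltonian is quadratic in them, with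
the symmetric matrix `h - J A`, where `A` is the adjacency matrix of the path
(`hamiltonian_eq_sum_jwString`). Sine waves diagonalize `A` (`exists_orthogonal_modes`), and a
rotation by a real orthogonal matrix preserves the Clifford relations, so that
`H(h) = ∑ₖ (h + 2 J cos θₖ) Zₖ` with `θₖ = π (k + 1) / (n + 1)`, `k = 0, …, n - 1`, and commuting
Hermitian involutions `Zₖ` (`hamiltonian_eq_sum_modeParity`). Each `Zₖ` is reversed by a Majorana
operator that commutes with all the others. Hence every choice of signs has a joint eigenvector, and
these eigenvectors form one orthonormal basis, independent of `J` and `h`, which diagonalizes all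
`H(h)` and `S_z` (`exists_eigenbasis`): the energies are `∑ₖ (h + 2 J cos θₖ) εₖ`, the spins are
`∑ₖ εₖ`. The partition function is then a product over the modes.

The energy is least when each `εₖ` is opposite in sign to `h + 2 J cos θₖ`, a mode of energy zero
being free. For `J > 0` and `|h|` below the critical field, which is the least of the numbers
`2 J |cos θₖ|`, the signs are those at `h = 0`, where half of the modes are down. At the critical
field exactly one mode has energy zero, and beyond it more than half of the modes have the sign
opposite to `h`.

Time reversal commutes with `H(0)` and preserves norms, so it fixes a non-degenerate ground state of
`H(0)` up to a phase, and the concurrence is one (`concurrence_eq_one`). On the other hand it flips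
all spins, so a state supported on configurations whose total spins are all positive, or all
negative, is orthogonal to its time reversal (`concurrence_eq_zero_of_sign`).
-/

open scoped Matrix

namespace XXChain

/-! ### Tensor products of one-qubit operators -/

theorem tensorOp_mul {n : ℕ} (A B : Fin n → Matrix (Fin 2) (Fin 2) ℂ) :
    tensorOp A * tensorOp B = tensorOp fun j => A j * B j := by
  ext s t
  simp only [tensorOp, Matrix.mul_apply, Matrix.of_apply, Finset.prod_univ_sum,
    Fintype.piFinset_univ, Finset.prod_mul_distrib]

theorem tensorOp_smul {n : ℕ} (c : Fin n → ℂ) (A : Fin n → Matrix (Fin 2) (Fin 2) ℂ) :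
    (tensorOp fun j => c j • A j) = (∏ j, c j) • tensorOp A := by
  ext s t
  simp [tensorOp, Finset.prod_mul_distrib]

theorem tensorOp_one {n : ℕ} : tensorOp (1 : Fin n → Matrix (Fin 2) (Fin 2) ℂ) = 1 := by
  ext s t
  by_cases h : s = t
  · simp [tensorOp, h, Matrix.one_apply]
  · obtain ⟨j, hj⟩ := Function.ne_iff.1 h
    rw [Matrix.one_apply_ne h]
    exact Finset.prod_eq_zero (Finset.mem_univ j) (Matrix.one_apply_ne hj)

theorem tensorOp_conjTranspose {n : ℕ} (A : Fin n → Matrix (Fin 2) (Fin 2) ℂ) :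
    (tensorOp A)ᴴ = tensorOp fun j => (A j)ᴴ := by
  ext s t
  simp [tensorOp]

theorem tensorOp_map_conj {n : ℕ} (A : Fin n → Matrix (Fin 2) (Fin 2) ℂ) :
    (tensorOp A).map (starRingEnd ℂ) = tensorOp fun j => (A j).map (starRingEnd ℂ) := by
  ext s t
  simp [tensorOp]

theorem pauliZ_mul_self : pauliZ * pauliZ = 1 := by
  ext i j; fin_cases i <;> fin_cases j <;> simp [pauliZ]

theorem pauliX_mul_self : pauliX * pauliX = 1 := by
  ext i j; fin_cases i <;> fin_cases j <;> simp [pauliX]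

theorem pauliY_mul_self : pauliY * pauliY = 1 := by
  ext i j; fin_cases i <;> fin_cases j <;> simp [pauliY]

theorem pauliX_mul_pauliY : pauliX * pauliY = Complex.I • pauliZ := by
  ext i j; fin_cases i <;> fin_cases j <;> simp [pauliX, pauliY, pauliZ]

theorem pauliY_mul_pauliX : pauliY * pauliX = -(pauliX * pauliY) := by
  ext i j; fin_cases i <;> fin_cases j <;> simp [pauliX, pauliY]

theorem pauliX_mul_pauliZ : pauliX * pauliZ = -Complex.I • pauliY := by
  ext i j; fin_cases i <;> fin_cases j <;> simp [pauliX, pauliY, pauliZ]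

theorem pauliZ_mul_pauliX : pauliZ * pauliX = -(pauliX * pauliZ) := by
  ext i j; fin_cases i <;> fin_cases j <;> simp [pauliX, pauliZ]

theorem pauliZ_mul_pauliY : pauliZ * pauliY = -(pauliY * pauliZ) := by
  ext i j; fin_cases i <;> fin_cases j <;> simp [pauliY, pauliZ]

theorem pauliZ_mul_pauliY' : pauliZ * pauliY = -Complex.I • pauliX := by
  ext i j; fin_cases i <;> fin_cases j <;> simp [pauliX, pauliY, pauliZ]

theorem pauliX_isHermitian : pauliXᴴ = pauliX := by
  ext i j; fin_cases i <;> fin_cases j <;> simp [pauliX]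

theorem pauliY_isHermitian : pauliYᴴ = pauliY := by
  ext i j; fin_cases i <;> fin_cases j <;> simp [pauliY]

theorem pauliZ_isHermitian : pauliZᴴ = pauliZ := by
  ext i j; fin_cases i <;> fin_cases j <;> simp [pauliZ]

theorem siteOp_smul {n : ℕ} (c : ℂ) (A : Matrix (Fin 2) (Fin 2) ℂ) (j : Fin n) :
    siteOp (c • A) j = c • siteOp A j := by
  have h : (Pi.mulSingle j (c • A) : Fin n → Matrix (Fin 2) (Fin 2) ℂ) =
      fun i => (Pi.mulSingle j c : Fin n → ℂ) i • (Pi.mulSingle j A : Fin n → _) i := by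
    funext i
    by_cases hi : i = j
    · subst hi; simp
    · simp [hi]
  rw [siteOp, h, tensorOp_smul, Finset.prod_pi_mulSingle']
  simp [siteOp]

/-! ### The Jordan–Wigner transformation -/

/-- The Jordan–Wigner string `σ₁ᶻ ⋯ σⱼ₋₁ᶻ Aⱼ`. For `A = σˣ` and `A = σʸ` these are the `2n`
Majorana operators of the chain. -/
noncomputable def jwString {n : ℕ} (A : Matrix (Fin 2) (Fin 2) ℂ) (j : Fin n) : Op n :=
  tensorOp fun i => if i < j then pauliZ else if i = j then A else 1

theorem jwString_isHermitian {n : ℕ} {A : Matrix (Fin 2) (Fin 2) ℂ} (hA : Aᴴ = A) (j : Fin n) :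
    (jwString A j)ᴴ = jwString A j := by
  rw [jwString, tensorOp_conjTranspose]
  congr 1
  funext i
  split_ifs <;> simp [hA, pauliZ_isHermitian]

theorem jwString_mul_self {n : ℕ} (A B : Matrix (Fin 2) (Fin 2) ℂ) (j : Fin n) :
    jwString A j * jwString B j = siteOp (A * B) j := by
  rw [jwString, jwString, tensorOp_mul, siteOp]
  congr 1
  funext i
  rcases lt_trichotomy i j with h | h | h
  · simp [h, h.ne, pauliZ_mul_self]
  · subst h; simp
  · simp [h.not_gt, h.ne']

theorem jwString_anticomm_of_lt {n : ℕ} {A : Matrix (Fin 2) (Fin 2) ℂ}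
    (B : Matrix (Fin 2) (Fin 2) ℂ) (hA : pauliZ * A = -(A * pauliZ)) {i j : Fin n} (h : i < j) :
    jwString A i * jwString B j + jwString B j * jwString A i = 0 := by
  -- the two products differ only at the site `i`, where `A` meets `σᶻ`
  have key : jwString A i * jwString B j =
      (∏ m, (Pi.mulSingle i (-1) : Fin n → ℂ) m) • (jwString B j * jwString A i) := by
    simp only [jwString, tensorOp_mul]
    rw [← tensorOp_smul]
    congr 1
    funext m
    rcases lt_trichotomy m i with hm | hm | hm
    · simp [hm, hm.trans h, hm.ne]
    · subst hm; simp [h, hA]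
    · simp [hm.not_gt, hm.ne']
  rw [key, Finset.prod_pi_mulSingle']
  simp

theorem jwString_anticomm {n : ℕ} {A B : Matrix (Fin 2) (Fin 2) ℂ}
    (hA : pauliZ * A = -(A * pauliZ)) (hB : pauliZ * B = -(B * pauliZ)) {i j : Fin n}
    (h : i ≠ j) : jwString A i * jwString B j + jwString B j * jwString A i = 0 := by
  rcases h.lt_or_gt with h | h
  · exact jwString_anticomm_of_lt B hA h
  · rw [add_comm]; exact jwString_anticomm_of_lt A hB h

theorem jwString_mul_succ {n : ℕ} (A B : Matrix (Fin 2) (Fin 2) ℂ) {i j : Fin n}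
    (h : (j : ℕ) = i + 1) : jwString A i * jwString B j = siteOp (A * pauliZ) i * siteOp B j := by
  rw [jwString, jwString, siteOp, siteOp, tensorOp_mul, tensorOp_mul]
  congr 1
  funext m
  have hij : i < j := by rw [Fin.lt_def]; omega
  rcases lt_trichotomy m i with hm | hm | hm
  · simp [hm, hm.trans hij, hm.ne, (hm.trans hij).ne, pauliZ_mul_self]
  · subst hm; simp [hij, hij.ne]
  · have : ¬ m < j := by rw [Fin.lt_def] at *; omega
    by_cases hmj : m = j
    · subst hmj; simp [hm.not_gt, hm.ne']
    · simp [hm.not_gt, hm.ne', this, hmj]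

theorem jwString_succ_mul {n : ℕ} (A B : Matrix (Fin 2) (Fin 2) ℂ) {i j : Fin n}
    (h : (j : ℕ) = i + 1) : jwString A j * jwString B i = siteOp (pauliZ * B) i * siteOp A j := by
  rw [jwString, jwString, siteOp, siteOp, tensorOp_mul, tensorOp_mul]
  congr 1
  funext m
  have hij : i < j := by rw [Fin.lt_def]; omega
  rcases lt_trichotomy m i with hm | hm | hm
  · simp [hm, hm.trans hij, hm.ne, (hm.trans hij).ne, pauliZ_mul_self]
  · subst hm; simp [hij, hij.ne]
  · have : ¬ m < j := by rw [Fin.lt_def] at *; omega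
    by_cases hmj : m = j
    · subst hmj; simp [hm.not_gt, hm.ne']
    · simp [hm.not_gt, hm.ne', this, hmj]

/-- Anticommutators are bilinear; an orthogonal rotation therefore preserves Clifford relations. -/
theorem sum_smul_anticomm {ι R : Type*} [Fintype ι] [Ring R] [Algebra ℝ R] (a b : ι → ℝ)
    (x y : ι → R) :
    (∑ i, a i • x i) * (∑ j, b j • y j) + (∑ j, b j • y j) * (∑ i, a i • x i) =
      ∑ i, ∑ j, (a i * b j) • (x i * y j + y j * x i) := by
  rw [Finset.sum_mul_sum, Finset.sum_mul_sum, Finset.sum_comm (s := Finset.univ (α := ι)),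
    ← Finset.sum_add_distrib, Finset.sum_comm]
  refine Finset.sum_congr rfl fun i _ => ?_
  rw [← Finset.sum_add_distrib]
  refine Finset.sum_congr rfl fun j _ => ?_
  simp only [smul_mul_smul_comm, smul_add, mul_comm (a _) (b _)]

/-! ### Normal modes of the open chain -/

/-- The adjacency matrix of the path with `n` vertices. -/
def pathAdj (n : ℕ) : Matrix (Fin n) (Fin n) ℝ :=
  Matrix.of fun i j => (if (i : ℕ) + 1 = j then 1 else 0) + (if (j : ℕ) + 1 = i then 1 else 0)

theorem pathAdj_transpose (n : ℕ) : (pathAdj n)ᵀ = pathAdj n := by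
  ext i j
  simp [pathAdj, add_comm]

/-- The momentum `π (k + 1) / (n + 1)` of the `k`-th standing wave on `n` sites, counting `k`
from zero. -/
noncomputable def momentum (n k : ℕ) : ℝ := Real.pi * (k + 1 : ℕ) / (n + 1)

theorem sum_ite_succ_eq (n : ℕ) (f : ℕ → ℝ) (hn : f (n + 1) = 0) (i : Fin n) :
    ∑ j : Fin n, (if (i : ℕ) + 1 = j then f (j + 1) else 0) = f (i + 2) := by
  by_cases h : (i : ℕ) + 1 < n
  · rw [Finset.sum_eq_single ⟨i + 1, h⟩]
    · simp
    · intro j _ hj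
      exact if_neg fun h' => hj (Fin.ext h'.symm)
    · simp
  · have h1 : (i : ℕ) + 2 = n + 1 := by omega
    rw [h1, hn]
    exact Finset.sum_eq_zero fun j _ => if_neg (by omega)

theorem sum_ite_eq_succ (n : ℕ) (f : ℕ → ℝ) (h0 : f 0 = 0) (i : Fin n) :
    ∑ j : Fin n, (if (j : ℕ) + 1 = i then f (j + 1) else 0) = f i := by
  by_cases h : (i : ℕ) = 0
  · rw [h, h0]
    exact Finset.sum_eq_zero fun j _ => if_neg (by omega)
  · rw [Finset.sum_eq_single ⟨i - 1, by omega⟩]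
    · have : (i : ℕ) - 1 + 1 = i := by omega
      simp [this]
    · intro j _ hj
      refine if_neg fun h' => hj (Fin.ext ?_)
      simp only; omega
    · simp

theorem pathAdj_mulVec_sin (n k : ℕ) :
    pathAdj n *ᵥ (fun j : Fin n => Real.sin ((j + 1 : ℕ) * momentum n k)) =
      (2 * Real.cos (momentum n k)) • fun j : Fin n => Real.sin ((j + 1 : ℕ) * momentum n k) := by
  have hne : (n : ℝ) + 1 ≠ 0 := by positivity
  funext i
  have h0 : Real.sin (((0 : ℕ) : ℝ) * momentum n k) = 0 := by simp
  have hn : Real.sin (((n + 1 : ℕ) : ℝ) * momentum n k) = 0 := by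
    rw [show (((n + 1 : ℕ) : ℝ) * momentum n k) = (k + 1 : ℕ) * Real.pi by
      rw [momentum]; push_cast; field_simp]
    exact Real.sin_nat_mul_pi _
  have e1 := sum_ite_succ_eq n (fun m => Real.sin ((m : ℝ) * momentum n k)) hn i
  have e2 := sum_ite_eq_succ n (fun m => Real.sin ((m : ℝ) * momentum n k)) h0 i
  simp only [Matrix.mulVec, dotProduct, pathAdj, Matrix.of_apply, add_mul, ite_mul, one_mul,
    zero_mul, Finset.sum_add_distrib, Pi.smul_apply, smul_eq_mul] at e1 e2 ⊢
  rw [e1, e2]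
  have s1 : ((i + 2 : ℕ) : ℝ) * momentum n k = ((i + 1 : ℕ) : ℝ) * momentum n k + momentum n k := by
    push_cast; ring
  have s2 : ((i : ℕ) : ℝ) * momentum n k = ((i + 1 : ℕ) : ℝ) * momentum n k - momentum n k := by
    push_cast; ring
  rw [s1, s2, Real.sin_add, Real.sin_sub]
  ring

theorem momentum_mem (n : ℕ) {k : ℕ} (hk : k < n) : momentum n k ∈ Set.Ioo 0 Real.pi := by
  have hne : (0 : ℝ) < (n : ℝ) + 1 := by positivity
  have hk' : (k : ℝ) < n := by exact_mod_cast hk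
  refine ⟨by unfold momentum; positivity, ?_⟩
  rw [momentum, div_lt_iff₀ hne]
  push_cast
  nlinarith [Real.pi_pos]

theorem momentum_strictMono (n : ℕ) : StrictMono (momentum n) := by
  intro k l hkl
  have hne : (0 : ℝ) < (n : ℝ) + 1 := by positivity
  have : (k : ℝ) < l := by exact_mod_cast hkl
  unfold momentum
  push_cast
  gcongr

theorem cos_momentum_strictAnti (n : ℕ) {k l : ℕ} (hl : l < n) (h : k < l) :
    Real.cos (momentum n l) < Real.cos (momentum n k) :=
  Real.cos_lt_cos_of_nonneg_of_le_pi (momentum_mem n (h.trans hl)).1.le (momentum_mem n hl).2.le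
    (momentum_strictMono n h)

theorem cos_momentum_rev (n : ℕ) (k : Fin n) :
    Real.cos (momentum n (Fin.rev k)) = -Real.cos (momentum n k) := by
  rw [← Real.cos_pi_sub]
  congr 1
  have hne : (n : ℝ) + 1 ≠ 0 := by positivity
  have hk : (k : ℕ) + 1 ≤ n := k.2
  simp only [momentum, Fin.val_rev]
  push_cast [hk]
  field_simp
  ring

/-- The real orthogonal matrix of standing waves. The orthogonality of the sine waves follows from
the fact that they belong to distinct eigenvalues of a symmetric matrix. The order of the modes is
reversed so that the mode `k` has eigenvalue `-2 cos θₖ`. -/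
theorem exists_orthogonal_modes (n : ℕ) : ∃ Φ : Matrix (Fin n) (Fin n) ℝ, Φ * Φᵀ = 1 ∧
    ∀ k, pathAdj n *ᵥ Φ k = (-2 * Real.cos (momentum n k)) • Φ k := by
  set v : Fin n → Fin n → ℝ :=
    fun k j => Real.sin ((j + 1 : ℕ) * momentum n (Fin.rev k)) with hv
  have hAv : ∀ k, pathAdj n *ᵥ v k = (-2 * Real.cos (momentum n k)) • v k := fun k => by
    rw [hv, pathAdj_mulVec_sin, cos_momentum_rev]
    simp
  have horth : ∀ k l, k ≠ l → v k ⬝ᵥ v l = 0 := by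
    intro k l hkl
    have h1 : v k ⬝ᵥ (pathAdj n *ᵥ v l) = (pathAdj n *ᵥ v k) ⬝ᵥ v l := by
      rw [Matrix.dotProduct_mulVec, ← Matrix.mulVec_transpose, pathAdj_transpose]
    rw [hAv, hAv, dotProduct_smul, smul_dotProduct, smul_eq_mul, smul_eq_mul] at h1
    have hc : Real.cos (momentum n k) ≠ Real.cos (momentum n l) := by
      rcases hkl.lt_or_gt with h | h
      · exact (cos_momentum_strictAnti n l.2 h).ne'
      · exact (cos_momentum_strictAnti n k.2 h).ne
    have h2 : (Real.cos (momentum n k) - Real.cos (momentum n l)) * (v k ⬝ᵥ v l) = 0 := by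
      linear_combination h1 / 2
    exact (mul_eq_zero.1 h2).resolve_left (sub_ne_zero.2 hc)
  have hpos : ∀ k, 0 < v k ⬝ᵥ v k := by
    intro k
    have hn : 0 < n := k.pos
    refine Finset.sum_pos' (fun j _ => mul_self_nonneg _) ⟨⟨0, hn⟩, Finset.mem_univ _, ?_⟩
    have := momentum_mem n (Fin.rev k).2
    have hs := Real.sin_pos_of_pos_of_lt_pi this.1 this.2
    simp only [hv, zero_add, Nat.cast_one, one_mul]
    exact mul_pos hs hs
  refine ⟨Matrix.of fun k => (√(v k ⬝ᵥ v k))⁻¹ • v k, ?_, fun k => ?_⟩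
  · ext k l
    rw [Matrix.mul_apply]
    change ((√(v k ⬝ᵥ v k))⁻¹ • v k) ⬝ᵥ ((√(v l ⬝ᵥ v l))⁻¹ • v l) = _
    rw [dotProduct_smul, smul_dotProduct, smul_eq_mul, smul_eq_mul]
    by_cases h : k = l
    · subst h
      have h1 := (Real.sqrt_pos.2 (hpos k)).ne'
      have h2 := Real.mul_self_sqrt (hpos k).le
      rw [Matrix.one_apply_eq]
      field_simp
      linarith
    · rw [horth k l h, Matrix.one_apply_ne h]; simp
  · change pathAdj n *ᵥ ((√(v k ⬝ᵥ v k))⁻¹ • v k) = _ • ((√(v k ⬝ᵥ v k))⁻¹ • v k)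
    rw [Matrix.mulVec_smul, hAv, smul_comm]

/-- The spectral decomposition of the one-particle matrix `h - J A`. -/
theorem sum_modes {n : ℕ} {Φ : Matrix (Fin n) (Fin n) ℝ} (hΦ : Φ * Φᵀ = 1)
    (hA : ∀ k, pathAdj n *ᵥ Φ k = (-2 * Real.cos (momentum n k)) • Φ k) (J h : ℝ) (i j : Fin n) :
    ∑ k : Fin n, (h + 2 * J * Real.cos (momentum n k)) * (Φ k i * Φ k j) =
      (if i = j then h else 0) - J * pathAdj n i j := by
  have hΦ' : Φᵀ * Φ = 1 := mul_eq_one_comm.1 hΦ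
  have h1 : ∑ k : Fin n, Φ k i * Φ k j = if i = j then 1 else 0 := by
    have := congrFun (congrFun hΦ' i) j
    simpa [Matrix.mul_apply, Matrix.one_apply] using this
  have h2 : ∑ k : Fin n, -2 * Real.cos (momentum n k) * (Φ k i * Φ k j) = pathAdj n i j := by
    have : pathAdj n * Φᵀ * Φ = pathAdj n := by rw [Matrix.mul_assoc, hΦ', mul_one]
    rw [← congrFun (congrFun this i) j, Matrix.mul_apply]
    refine Finset.sum_congr rfl fun k _ => ?_
    have := congrFun (hA k) i
    rw [← mul_assoc]
    congr 1
    exact this.symm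
  calc _ = h * (∑ k : Fin n, Φ k i * Φ k j) -
        J * ∑ k : Fin n, -2 * Real.cos (momentum n k) * (Φ k i * Φ k j) := by
        rw [Finset.mul_sum, Finset.mul_sum, ← Finset.sum_sub_distrib]
        exact Finset.sum_congr rfl fun k _ => by ring
    _ = _ := by rw [h1, h2]; simp

/-! ### Diagonalization of the Hamiltonian -/

/-- The rotated Majorana operators `∑ⱼ Φ k j σ₁ᶻ ⋯ σⱼ₋₁ᶻ Aⱼ`. -/
noncomputable def modeMajorana {n : ℕ} (Φ : Matrix (Fin n) (Fin n) ℝ)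
    (A : Matrix (Fin 2) (Fin 2) ℂ) (k : Fin n) : Op n :=
  ∑ j, Φ k j • jwString A j

/-- The parity `2 c†ₖ cₖ - 1` of the fermionic mode `k`, written as `-i` times the product of its
two Majorana operators. -/
noncomputable def modeParity {n : ℕ} (Φ : Matrix (Fin n) (Fin n) ℝ) (k : Fin n) : Op n :=
  -Complex.I • (modeMajorana Φ pauliX k * modeMajorana Φ pauliY k)

theorem modeMajorana_isHermitian {n : ℕ} (Φ : Matrix (Fin n) (Fin n) ℝ)
    {A : Matrix (Fin 2) (Fin 2) ℂ} (hA : Aᴴ = A) (k : Fin n) :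
    (modeMajorana Φ A k)ᴴ = modeMajorana Φ A k := by
  simp [modeMajorana, Matrix.conjTranspose_sum, jwString_isHermitian hA]

theorem modeMajorana_anticomm {n : ℕ} {Φ : Matrix (Fin n) (Fin n) ℝ}
    {A B : Matrix (Fin 2) (Fin 2) ℂ} (hA : pauliZ * A = -(A * pauliZ))
    (hB : pauliZ * B = -(B * pauliZ)) (hAB : A * B + B * A = 0) (k l : Fin n) :
    modeMajorana Φ A k * modeMajorana Φ B l = -(modeMajorana Φ B l * modeMajorana Φ A k) := by
  refine eq_neg_of_add_eq_zero_left ?_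
  rw [modeMajorana, modeMajorana, sum_smul_anticomm]
  refine Finset.sum_eq_zero fun i _ => Finset.sum_eq_zero fun j _ => ?_
  by_cases hij : i = j
  · subst hij
    rw [jwString_mul_self, jwString_mul_self, eq_neg_of_add_eq_zero_left hAB, ← neg_one_smul ℂ,
      siteOp_smul]
    simp
  · rw [jwString_anticomm hA hB hij, smul_zero]

theorem modeMajorana_clifford {n : ℕ} {Φ : Matrix (Fin n) (Fin n) ℝ} (hΦ : Φ * Φᵀ = 1)
    {A : Matrix (Fin 2) (Fin 2) ℂ} (hA : pauliZ * A = -(A * pauliZ)) (hAA : A * A = 1)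
    (k l : Fin n) :
    modeMajorana Φ A k * modeMajorana Φ A l + modeMajorana Φ A l * modeMajorana Φ A k =
      if k = l then 2 else 0 := by
  have hsite : ∀ i : Fin n, siteOp (1 : Matrix (Fin 2) (Fin 2) ℂ) i = 1 := fun i => by
    rw [siteOp, Pi.mulSingle_one, tensorOp_one]
  have hin : ∀ i, ∑ j, (Φ k i * Φ l j) • (jwString A i * jwString A j +
      jwString A j * jwString A i) = (Φ k i * Φ l i) • (2 : Op n) := by
    intro i
    rw [Finset.sum_eq_single i]
    · rw [jwString_mul_self, hAA, hsite, one_add_one_eq_two]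
    · intro j _ hj
      rw [jwString_anticomm hA hA hj.symm, smul_zero]
    · simp
  rw [modeMajorana, modeMajorana, sum_smul_anticomm, Finset.sum_congr rfl fun i _ => hin i,
    ← Finset.sum_smul]
  have : ∑ i, Φ k i * Φ l i = (Φ * Φᵀ) k l := by simp [Matrix.mul_apply]
  rw [this, hΦ, Matrix.one_apply]
  split_ifs <;> simp

theorem modeMajorana_sq {n : ℕ} {Φ : Matrix (Fin n) (Fin n) ℝ} (hΦ : Φ * Φᵀ = 1)
    {A : Matrix (Fin 2) (Fin 2) ℂ} (hA : pauliZ * A = -(A * pauliZ)) (hAA : A * A = 1)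
    (k : Fin n) : modeMajorana Φ A k * modeMajorana Φ A k = 1 := by
  have h := modeMajorana_clifford hΦ hA hAA k k
  rw [if_pos rfl, ← two_smul ℂ, show (2 : Op n) = (2 : ℂ) • 1 by rw [two_smul]; norm_num] at h
  exact smul_right_injective _ (two_ne_zero (α := ℂ)) h

theorem modeMajorana_swap {n : ℕ} {Φ : Matrix (Fin n) (Fin n) ℝ} (hΦ : Φ * Φᵀ = 1)
    {A : Matrix (Fin 2) (Fin 2) ℂ} (hA : pauliZ * A = -(A * pauliZ)) (hAA : A * A = 1)
    {k l : Fin n} (hkl : k ≠ l) :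
    modeMajorana Φ A k * modeMajorana Φ A l = -(modeMajorana Φ A l * modeMajorana Φ A k) := by
  have h := modeMajorana_clifford hΦ hA hAA k l
  rw [if_neg hkl] at h
  exact eq_neg_of_add_eq_zero_left h

theorem modeMajorana_X_mul_Y {n : ℕ} (Φ : Matrix (Fin n) (Fin n) ℝ) (k l : Fin n) :
    modeMajorana Φ pauliX k * modeMajorana Φ pauliY l =
      -(modeMajorana Φ pauliY l * modeMajorana Φ pauliX k) :=
  modeMajorana_anticomm pauliZ_mul_pauliX pauliZ_mul_pauliY
    (by rw [pauliY_mul_pauliX, add_neg_cancel]) k l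

theorem modeParity_isHermitian {n : ℕ} (Φ : Matrix (Fin n) (Fin n) ℝ) (k : Fin n) :
    (modeParity Φ k).IsHermitian := by
  rw [Matrix.IsHermitian, modeParity, Matrix.conjTranspose_smul, Matrix.conjTranspose_mul,
    modeMajorana_isHermitian Φ pauliX_isHermitian, modeMajorana_isHermitian Φ pauliY_isHermitian,
    modeMajorana_X_mul_Y]
  simp

theorem modeParity_sq {n : ℕ} {Φ : Matrix (Fin n) (Fin n) ℝ} (hΦ : Φ * Φᵀ = 1) (k : Fin n) :
    modeParity Φ k * modeParity Φ k = 1 := by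
  have hX := modeMajorana_sq hΦ pauliZ_mul_pauliX pauliX_mul_self k
  have hY := modeMajorana_sq hΦ pauliZ_mul_pauliY pauliY_mul_self k
  have hXY := modeMajorana_X_mul_Y Φ k k
  rw [modeParity, smul_mul_smul_comm]
  generalize modeMajorana Φ pauliX k = x at *
  generalize modeMajorana Φ pauliY k = y at *
  have : x * y * (x * y) = -1 := by
    calc x * y * (x * y) = -(y * x) * (x * y) := by rw [hXY]
      _ = -(y * (x * x) * y) := by noncomm_ring
      _ = -1 := by rw [hX, mul_one, hY]
  rw [this]
  simp

theorem modeMajorana_mul_modeParity_self {n : ℕ} {Φ : Matrix (Fin n) (Fin n) ℝ} (k : Fin n) :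
    modeMajorana Φ pauliX k * modeParity Φ k = -(modeParity Φ k * modeMajorana Φ pauliX k) := by
  have hXY := modeMajorana_X_mul_Y Φ k k
  rw [modeParity, mul_smul_comm, smul_mul_assoc, ← smul_neg, mul_assoc, hXY]
  rw [mul_neg]

theorem modeMajorana_mul_modeParity {n : ℕ} {Φ : Matrix (Fin n) (Fin n) ℝ} (hΦ : Φ * Φᵀ = 1)
    {k l : Fin n} (hkl : k ≠ l) :
    modeMajorana Φ pauliX k * modeParity Φ l = modeParity Φ l * modeMajorana Φ pauliX k := by
  have hXX := modeMajorana_swap hΦ pauliZ_mul_pauliX pauliX_mul_self hkl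
  have hXY := modeMajorana_X_mul_Y Φ k l
  rw [modeParity, mul_smul_comm, smul_mul_assoc, ← mul_assoc, hXX, neg_mul, mul_assoc, hXY,
    mul_neg, neg_neg, mul_assoc]

theorem modeParity_commute {n : ℕ} {Φ : Matrix (Fin n) (Fin n) ℝ} (hΦ : Φ * Φᵀ = 1)
    (k l : Fin n) : modeParity Φ k * modeParity Φ l = modeParity Φ l * modeParity Φ k := by
  rcases eq_or_ne k l with rfl | hkl
  · rfl
  have hYY := modeMajorana_swap hΦ pauliZ_mul_pauliY pauliY_mul_self hkl
  have hXY := modeMajorana_X_mul_Y Φ l k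
  have hY : modeMajorana Φ pauliY k * modeParity Φ l =
      modeParity Φ l * modeMajorana Φ pauliY k := by
    rw [modeParity, mul_smul_comm, smul_mul_assoc, ← mul_assoc,
      show modeMajorana Φ pauliY k * modeMajorana Φ pauliX l =
        -(modeMajorana Φ pauliX l * modeMajorana Φ pauliY k) by rw [hXY, neg_neg],
      neg_mul, mul_assoc, hYY, mul_neg, neg_neg, mul_assoc]
  have hX := modeMajorana_mul_modeParity hΦ hkl
  conv_lhs => rw [modeParity]
  conv_rhs => rw [modeParity.eq_def Φ k]
  rw [smul_mul_assoc, mul_smul_comm, mul_assoc, hY, ← mul_assoc, hX, mul_assoc]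

theorem sum_sum_ite_succ {n : ℕ} {M : Type*} [AddCommMonoid M] (G : Fin n → Fin n → M) :
    ∑ i : Fin n, ∑ j : Fin n, (if (i : ℕ) + 1 = j then G i j else 0) =
      ∑ j : Fin (n - 1), G ⟨j, by omega⟩ ⟨j + 1, by omega⟩ := by
  cases n with
  | zero => simp
  | succ m =>
    rw [Fin.sum_univ_castSucc]
    rw [Finset.sum_eq_zero (f := fun j : Fin (m + 1) => ite ((Fin.last m : ℕ) + 1 = j) _ _)
      fun j _ => if_neg (by have := j.2; simp only [Fin.val_last]; omega), add_zero]
    refine Finset.sum_congr rfl fun i _ => ?_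
    rw [Finset.sum_eq_single ⟨i + 1, by omega⟩]
    · simp; rfl
    · intro j _ hj
      exact if_neg fun h => hj (Fin.ext h.symm)
    · simp

/-- The XX Hamiltonian is quadratic in the Majorana operators, with the matrix `h - J A` for `A`
the adjacency matrix of the path. -/
theorem hamiltonian_eq_sum_jwString (n : ℕ) (J h : ℝ) :
    hamiltonian n J h = ∑ i, ∑ j, ((if i = j then h else 0) - J * pathAdj n i j) •
      (-Complex.I • (jwString pauliX i * jwString pauliY j) : Op n) := by
  have hd : ∀ i : Fin n, (-Complex.I • (jwString pauliX i * jwString pauliY i) : Op n) =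
      siteOp pauliZ i := fun i => by
    rw [jwString_mul_self, pauliX_mul_pauliY, siteOp_smul, smul_smul]; simp
  have hu : ∀ i j : Fin n, (i : ℕ) + 1 = j →
      (-Complex.I • (jwString pauliX i * jwString pauliY j) : Op n) =
        -(siteOp pauliY i * siteOp pauliY j) := fun i j hij => by
    rw [jwString_mul_succ _ _ hij.symm, pauliX_mul_pauliZ, siteOp_smul, smul_mul_assoc, smul_smul]
    simp
  have hl : ∀ i j : Fin n, (i : ℕ) + 1 = j →
      (-Complex.I • (jwString pauliX j * jwString pauliY i) : Op n) =
        -(siteOp pauliX i * siteOp pauliX j) := fun i j hij => by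
    rw [jwString_succ_mul _ _ hij.symm, pauliZ_mul_pauliY', siteOp_smul, smul_mul_assoc, smul_smul]
    simp
  set G : Fin n → Fin n → Op n :=
    fun i j => -Complex.I • (jwString pauliX i * jwString pauliY j) with hG
  replace hd : ∀ i, G i i = siteOp pauliZ i := hd
  replace hu : ∀ i j : Fin n, (i : ℕ) + 1 = j →
      G i j = -(siteOp pauliY i * siteOp pauliY j) := hu
  replace hl : ∀ i j : Fin n, (i : ℕ) + 1 = j →
      G j i = -(siteOp pauliX i * siteOp pauliX j) := hl
  have hsplit : ∀ i j, ((if i = j then h else 0) - J * pathAdj n i j) • G i j =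
      (if i = j then h • siteOp pauliZ i else 0) +
      ((if (i : ℕ) + 1 = j then J • (siteOp pauliY i * siteOp pauliY j) else 0) +
      (if (j : ℕ) + 1 = i then J • (siteOp pauliX j * siteOp pauliX i) else 0)) := by
    intro i j
    simp only [pathAdj, Matrix.of_apply]
    by_cases h1 : i = j
    · subst h1
      simp [hd]
    by_cases h2 : (i : ℕ) + 1 = j
    · have h3 : ¬ (j : ℕ) + 1 = i := by omega
      simp [h1, h2, h3, hu i j h2]
    by_cases h3 : (j : ℕ) + 1 = i
    · simp [h1, h2, h3, hl j i h3]
    simp [h1, h2, h3]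
  rw [Finset.sum_congr rfl fun i _ => Finset.sum_congr rfl fun j _ => hsplit i j]
  simp only [Finset.sum_add_distrib]
  rw [sum_sum_ite_succ fun i j => J • (siteOp pauliY i * siteOp pauliY j), Finset.sum_comm
    (f := fun i j : Fin n => ite ((j : ℕ) + 1 = i) (J • (siteOp pauliX j * siteOp pauliX i)) 0),
    sum_sum_ite_succ fun i j => J • (siteOp pauliX i * siteOp pauliX j), ← Finset.sum_add_distrib]
  rw [hamiltonian, spinZ, add_comm]
  congr 1
  · simp [Finset.smul_sum]
  · refine Finset.sum_congr rfl fun j _ => ?_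
    rw [← smul_add, add_comm]
    exact Complex.coe_smul _ _

/-- In terms of the normal modes, `H(h) = ∑ₖ (h + 2 J cos θₖ) (2 c†ₖ cₖ - 1)`. -/
theorem hamiltonian_eq_sum_modeParity {n : ℕ} {Φ : Matrix (Fin n) (Fin n) ℝ} (hΦ : Φ * Φᵀ = 1)
    (hA : ∀ k, pathAdj n *ᵥ Φ k = (-2 * Real.cos (momentum n k)) • Φ k) (J h : ℝ) :
    hamiltonian n J h = ∑ k : Fin n, (h + 2 * J * Real.cos (momentum n k)) • modeParity Φ k := by
  rw [hamiltonian_eq_sum_jwString]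
  simp_rw [← sum_modes hΦ hA, Finset.sum_smul]
  rw [Finset.sum_congr rfl fun i _ => Finset.sum_comm, Finset.sum_comm]
  refine Finset.sum_congr rfl fun k _ => ?_
  rw [modeParity, modeMajorana, modeMajorana, Finset.sum_mul_sum, Finset.smul_sum, Finset.smul_sum]
  refine Finset.sum_congr rfl fun i _ => ?_
  rw [Finset.smul_sum, Finset.smul_sum]
  refine Finset.sum_congr rfl fun j _ => ?_
  rw [smul_mul_smul_comm, mul_smul, smul_comm (-Complex.I)]

theorem hamiltonian_zero_coupling (n : ℕ) : hamiltonian n 0 1 = spinZ n := by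
  simp [hamiltonian]

/-! ### The joint eigenbasis of the mode parities -/

/-- The eigenvalue of `σᶻ` on a basis state of one qubit. -/
def spinSign (a : Fin 2) : ℝ := if a = 0 then 1 else -1

theorem spinSign_mul_self (a : Fin 2) : spinSign a * spinSign a = 1 := by
  unfold spinSign; split_ifs <;> norm_num

theorem spinSign_injective : Function.Injective spinSign := by
  intro a b h
  fin_cases a <;> fin_cases b <;> first | rfl | (norm_num [spinSign] at h)

/-- Commuting involutions `Z k`, each of which is reversed by an involution `F k` that commutes
with the others, have joint eigenvectors for all choices of signs: project onto the wanted
eigenspaces one after the other, and apply `F k` first whenever the projection would vanish. -/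
theorem exists_joint_eigenvector {ι m : Type*} [Fintype ι] [DecidableEq ι] [Fintype m]
    [DecidableEq m] [Nonempty m] (Z F : ι → Matrix m m ℂ) (hZ : ∀ k, Z k * Z k = 1)
    (hF : ∀ k, F k * F k = 1) (hZZ : ∀ k l, Z k * Z l = Z l * Z k)
    (hFZ : ∀ k, F k * Z k = -(Z k * F k)) (hFZ' : ∀ k l, k ≠ l → F k * Z l = Z l * F k)
    (t : ι → Fin 2) :
    ∃ v : m → ℂ, v ≠ 0 ∧ ∀ k, Z k *ᵥ v = (spinSign (t k) : ℂ) • v := by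
  suffices h : ∀ s : Finset ι, ∃ v : m → ℂ, v ≠ 0 ∧
      ∀ k ∈ s, Z k *ᵥ v = (spinSign (t k) : ℂ) • v by
    obtain ⟨v, hv, hk⟩ := h Finset.univ
    exact ⟨v, hv, fun k => hk k (Finset.mem_univ k)⟩
  intro s
  induction s using Finset.induction_on with
  | empty => exact ⟨1, one_ne_zero, by simp⟩
  | insert l s hl ih =>
    obtain ⟨v, hv, hk⟩ := ih
    have hc : (spinSign (t l) : ℂ) * (spinSign (t l) : ℂ) = 1 := by
      exact_mod_cast spinSign_mul_self (t l)
    by_cases hw : v + (spinSign (t l) : ℂ) • (Z l *ᵥ v) = 0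
    · -- `v` has the opposite sign for `Z l`
      have hZv : Z l *ᵥ v = -(spinSign (t l) : ℂ) • v := by
        have := congrArg ((spinSign (t l) : ℂ) • ·) hw
        simp only [smul_add, smul_smul, hc, one_smul, smul_zero] at this
        rw [neg_smul]
        exact eq_neg_of_add_eq_zero_right this
      refine ⟨F l *ᵥ v, fun h0 => hv ?_, fun k hks => ?_⟩
      · have := congrArg (F l *ᵥ ·) h0
        simpa [Matrix.mulVec_mulVec, hF] using this
      · rcases Finset.mem_insert.1 hks with rfl | hks
        · rw [Matrix.mulVec_mulVec, show Z k * F k = -(F k * Z k) by rw [hFZ, neg_neg],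
            Matrix.neg_mulVec, ← Matrix.mulVec_mulVec, hZv, Matrix.mulVec_smul, neg_smul, neg_neg]
        · have hne : l ≠ k := fun h => hl (h ▸ hks)
          rw [Matrix.mulVec_mulVec, ← hFZ' l k hne, ← Matrix.mulVec_mulVec, hk k hks,
            Matrix.mulVec_smul]
    · refine ⟨_, hw, fun k hks => ?_⟩
      rcases Finset.mem_insert.1 hks with rfl | hks
      · rw [Matrix.mulVec_add, Matrix.mulVec_smul, Matrix.mulVec_mulVec, hZ, Matrix.one_mulVec,
          smul_add, smul_smul, hc, one_smul, add_comm]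
      · rw [Matrix.mulVec_add, Matrix.mulVec_smul, Matrix.mulVec_mulVec, hZZ,
          ← Matrix.mulVec_mulVec, hk k hks, Matrix.mulVec_smul, smul_add, smul_comm]

/-- Joint eigenvectors of Hermitian involutions, one for each choice of signs, can be taken
orthonormal; there are as many as basis configurations, so they form a basis. -/
theorem exists_joint_eigenbasis {n : ℕ} (Z F : Fin n → Op n) (hH : ∀ k, (Z k).IsHermitian)
    (hZ : ∀ k, Z k * Z k = 1) (hF : ∀ k, F k * F k = 1) (hZZ : ∀ k l, Z k * Z l = Z l * Z k)
    (hFZ : ∀ k, F k * Z k = -(Z k * F k)) (hFZ' : ∀ k l, k ≠ l → F k * Z l = Z l * F k) :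
    ∃ b : OrthonormalBasis (Config n) ℂ (Qubits n), ∀ t k,
      Matrix.toEuclideanLin (Z k) (b t) = (spinSign (t k) : ℂ) • b t := by
  choose v hv hZv using exists_joint_eigenvector Z F hZ hF hZZ hFZ hFZ'
  set u : Config n → Qubits n := fun t =>
    ((‖WithLp.toLp 2 (v t)‖⁻¹ : ℝ) : ℂ) • WithLp.toLp 2 (v t) with hu
  have hZu : ∀ t k, Matrix.toEuclideanLin (Z k) (u t) = (spinSign (t k) : ℂ) • u t := by
    intro t k
    rw [hu]
    simp only [map_smul]
    rw [Matrix.toLpLin_toLp, Matrix.toLin'_apply, hZv, WithLp.toLp_smul, smul_comm]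
  have hne : ∀ t, (WithLp.toLp 2 (v t) : Qubits n) ≠ 0 := fun t h => hv t (by
    simpa using congrArg WithLp.ofLp h)
  have hnorm : ∀ t, ‖u t‖ = 1 := fun t => by
    rw [hu]
    simp only [norm_smul, Complex.norm_real, norm_inv, norm_norm]
    exact inv_mul_cancel₀ (norm_ne_zero_iff.2 (hne t))
  clear_value u
  have hon : Orthonormal ℂ u := by
    refine ⟨hnorm, fun s t hst => ?_⟩
    obtain ⟨k, hk⟩ := Function.ne_iff.1 hst
    have hs := (Matrix.isSymmetric_toEuclideanLin_iff.2 (hH k)) (u s) (u t)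
    rw [hZu, hZu, inner_smul_left, inner_smul_right, Complex.conj_ofReal] at hs
    have : ((spinSign (s k) : ℂ) - spinSign (t k)) * inner ℂ (u s) (u t) = 0 := by
      rw [sub_mul, hs, sub_self]
    refine (mul_eq_zero.1 this).resolve_left (sub_ne_zero.2 fun h => hk ?_)
    exact spinSign_injective (by exact_mod_cast h)
  have hcard : Fintype.card (Config n) = Module.finrank ℂ (Qubits n) := by simp
  refine ⟨(basisOfOrthonormalOfCardEqFinrank hon hcard).toOrthonormalBasis (by simpa using hon), ?_⟩
  intro t k
  simpa using hZu t k

/-- The total energy `∑ₖ cₖ εₖ` of the configuration `t` of the modes, with single-mode energies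
`c`. As for qubits, the value `0` of `t k` stands for the sign `εₖ = 1` (up) and the value `1` for
`εₖ = -1` (down). With `c = 1` this is the spin. -/
noncomputable def modeEnergy {n : ℕ} (c : Fin n → ℝ) (t : Config n) : ℝ :=
  ∑ k, c k * spinSign (t k)

/-- The single-mode energies `h + 2 J cos θₖ`. -/
noncomputable def modeField (n : ℕ) (J h : ℝ) (k : Fin n) : ℝ :=
  h + 2 * J * Real.cos (momentum n k)

/-- A single orthonormal basis diagonalizes all the Hamiltonians `H(h)` and the collective spin. -/
theorem exists_eigenbasis (n : ℕ) : ∃ b : OrthonormalBasis (Config n) ℂ (Qubits n),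
    (∀ J h t, Matrix.toEuclideanLin (hamiltonian n J h) (b t) =
      (modeEnergy (modeField n J h) t : ℂ) • b t) ∧
    ∀ t, Matrix.toEuclideanLin (spinZ n) (b t) = (modeEnergy 1 t : ℂ) • b t := by
  obtain ⟨Φ, hΦ, hA⟩ := exists_orthogonal_modes n
  obtain ⟨b, hb⟩ := exists_joint_eigenbasis (modeParity Φ) (modeMajorana Φ pauliX)
    (modeParity_isHermitian Φ) (modeParity_sq hΦ)
    (modeMajorana_sq hΦ pauliZ_mul_pauliX pauliX_mul_self) (modeParity_commute hΦ)
    modeMajorana_mul_modeParity_self fun k l => modeMajorana_mul_modeParity hΦ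
  have hH : ∀ J h t, Matrix.toEuclideanLin (hamiltonian n J h) (b t) =
      (modeEnergy (modeField n J h) t : ℂ) • b t := by
    intro J h t
    rw [hamiltonian_eq_sum_modeParity hΦ hA]
    simp_rw [← Complex.coe_smul]
    rw [map_sum, LinearMap.sum_apply, modeEnergy]
    push_cast
    rw [Finset.sum_smul]
    refine Finset.sum_congr rfl fun k _ => ?_
    rw [map_smul, LinearMap.smul_apply, hb, smul_smul, modeField]
    push_cast
    rfl
  refine ⟨b, hH, fun t => ?_⟩
  -- the collective spin is the Hamiltonian with `J = 0` and `h = 1`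
  rw [← hamiltonian_zero_coupling, hH]
  congr 3
  funext k
  simp [modeField]

/-! ### Operators with an orthonormal eigenbasis -/

theorem inner_toEuclideanLin_eigenbasis {n : ℕ} {H : Op n}
    {b : OrthonormalBasis (Config n) ℂ (Qubits n)} {E : Config n → ℝ}
    (hb : ∀ t, Matrix.toEuclideanLin H (b t) = (E t : ℂ) • b t) (ψ : Qubits n) (t : Config n) :
    inner ℂ (b t) (Matrix.toEuclideanLin H ψ) = (E t : ℂ) * inner ℂ (b t) ψ := by
  conv_lhs => rw [← b.sum_repr' ψ]
  simp_rw [map_sum, map_smul, hb, inner_sum, inner_smul_right, b.inner_eq_ite]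
  simp [mul_comm]

theorem inner_eigenbasis_eq_zero {n : ℕ} {H : Op n}
    {b : OrthonormalBasis (Config n) ℂ (Qubits n)} {E : Config n → ℝ}
    (hb : ∀ t, Matrix.toEuclideanLin H (b t) = (E t : ℂ) • b t) {ψ : Qubits n} {e : ℝ}
    (hψ : Matrix.toEuclideanLin H ψ = (e : ℂ) • ψ) {t : Config n} (ht : E t ≠ e) :
    inner ℂ (b t) ψ = 0 := by
  have h := inner_toEuclideanLin_eigenbasis hb ψ t
  rw [hψ, inner_smul_right] at h
  have h' : ((E t : ℂ) - e) * inner ℂ (b t) ψ = 0 := by rw [sub_mul, h, sub_self]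
  exact (mul_eq_zero.1 h').resolve_left (sub_ne_zero.2 (by exact_mod_cast ht))

theorem toEuclideanLin_eq_smul {n : ℕ} {H : Op n}
    {b : OrthonormalBasis (Config n) ℂ (Qubits n)} {E : Config n → ℝ}
    (hb : ∀ t, Matrix.toEuclideanLin H (b t) = (E t : ℂ) • b t) {ψ : Qubits n} {e : ℝ}
    (hψ : ∀ t, E t ≠ e → inner ℂ (b t) ψ = 0) :
    Matrix.toEuclideanLin H ψ = (e : ℂ) • ψ := by
  refine b.toBasis.ext_elem fun t => ?_
  simp only [OrthonormalBasis.coe_toBasis_repr_apply, OrthonormalBasis.repr_apply_apply]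
  rw [inner_toEuclideanLin_eigenbasis hb, inner_smul_right]
  by_cases ht : E t = e
  · rw [ht]
  · rw [hψ t ht]; simp

theorem energies_eq_range {n : ℕ} {H : Op n}
    {b : OrthonormalBasis (Config n) ℂ (Qubits n)} {E : Config n → ℝ}
    (hb : ∀ t, Matrix.toEuclideanLin H (b t) = (E t : ℂ) • b t) :
    energies H = Set.range E := by
  ext e
  constructor
  · intro he
    obtain ⟨ψ, hψ, h0⟩ := Module.End.HasEigenvalue.exists_hasEigenvector he
    by_contra hne
    refine h0 (b.toBasis.ext_elem fun t => ?_)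
    simp only [OrthonormalBasis.coe_toBasis_repr_apply, OrthonormalBasis.repr_apply_apply]
    rw [inner_eigenbasis_eq_zero hb (Module.End.mem_eigenspace_iff.1 hψ) fun h => hne ⟨t, h⟩,
      inner_zero_right]
  · rintro ⟨t, rfl⟩
    exact Module.End.hasEigenvalue_of_hasEigenvector (x := b t)
      ⟨Module.End.mem_eigenspace_iff.2 (hb t), b.orthonormal.ne_zero t⟩

theorem isGroundEnergy_of_forall_le {n : ℕ} {H : Op n}
    {b : OrthonormalBasis (Config n) ℂ (Qubits n)} {E : Config n → ℝ}
    (hb : ∀ t, Matrix.toEuclideanLin H (b t) = (E t : ℂ) • b t) {t₀ : Config n}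
    (ht₀ : ∀ t, E t₀ ≤ E t) : IsGroundEnergy H (E t₀) := by
  rw [IsGroundEnergy, energies_eq_range hb]
  exact ⟨⟨t₀, rfl⟩, by rintro _ ⟨t, rfl⟩; exact ht₀ t⟩

theorem isGroundState_iff {n : ℕ} {H : Op n}
    {b : OrthonormalBasis (Config n) ℂ (Qubits n)} {E : Config n → ℝ}
    (hb : ∀ t, Matrix.toEuclideanLin H (b t) = (E t : ℂ) • b t) {t₀ : Config n}
    (ht₀ : ∀ t, E t₀ ≤ E t) (ψ : Qubits n) :
    IsGroundState H ψ ↔ ‖ψ‖ = 1 ∧ ∀ t, E t ≠ E t₀ → inner ℂ (b t) ψ = 0 := by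
  have hg := isGroundEnergy_of_forall_le hb ht₀
  constructor
  · rintro ⟨h1, e, he, hψ⟩
    obtain rfl : e = E t₀ := IsLeast.unique he hg
    exact ⟨h1, fun t ht => inner_eigenbasis_eq_zero hb hψ ht⟩
  · rintro ⟨h1, h⟩
    exact ⟨h1, E t₀, hg, toEuclideanLin_eq_smul hb h⟩

theorem finrank_eigenspace_eq_card {n : ℕ} {H : Op n}
    {b : OrthonormalBasis (Config n) ℂ (Qubits n)} {E : Config n → ℝ}
    (hb : ∀ t, Matrix.toEuclideanLin H (b t) = (E t : ℂ) • b t) (e : ℝ) (s : Finset (Config n))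
    (hs : ∀ t, t ∈ s ↔ E t = e) :
    Module.finrank ℂ (Module.End.eigenspace (Matrix.toEuclideanLin H) (e : ℂ)) = s.card := by
  have hspan : Module.End.eigenspace (Matrix.toEuclideanLin H) (e : ℂ) =
      Submodule.span ℂ (Set.range fun t : s => b t) := by
    apply le_antisymm
    · intro ψ hψ
      rw [← b.sum_repr' ψ]
      refine Submodule.sum_mem _ fun t _ => ?_
      by_cases ht : E t = e
      · exact Submodule.smul_mem _ _ (Submodule.subset_span ⟨⟨t, (hs t).2 ht⟩, rfl⟩)
      · rw [inner_eigenbasis_eq_zero hb (Module.End.mem_eigenspace_iff.1 hψ) ht, zero_smul]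
        exact Submodule.zero_mem _
    · rw [Submodule.span_le]
      rintro _ ⟨t, rfl⟩
      refine Module.End.mem_eigenspace_iff.2 ?_
      simp only
      rw [hb, (hs t).1 t.2]
  rw [hspan]
  refine (finrank_span_eq_card
    (b.orthonormal.linearIndependent.comp (fun t : s => (t : Config n))
      Subtype.val_injective)).trans ?_
  exact Fintype.card_coe s

theorem partitionFunction_eq_sum {n : ℕ} {H : Op n}
    {b : OrthonormalBasis (Config n) ℂ (Qubits n)} {E : Config n → ℝ}
    (hb : ∀ t, Matrix.toEuclideanLin H (b t) = (E t : ℂ) • b t) (β : ℝ) :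
    partitionFunction H β = ((∑ t, Real.exp (-β * E t) : ℝ) : ℂ) := by
  -- the unitary matrix whose columns are the eigenvectors
  set U : Op n := Matrix.of fun s t => b t s with hU
  have hUU : Uᴴ * U = 1 := by
    ext s t
    have h := b.inner_eq_ite s t
    rw [EuclideanSpace.inner_eq_star_dotProduct, dotProduct] at h
    rw [Matrix.mul_apply, Matrix.one_apply, ← h]
    refine Finset.sum_congr rfl fun r _ => ?_
    simp [hU, mul_comm]
  have hUU' : U * Uᴴ = 1 := mul_eq_one_comm.1 hUU
  have hHU : H * U = U * Matrix.diagonal fun t => (E t : ℂ) := by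
    ext s t
    rw [Matrix.mul_diagonal]
    have h := congrArg (fun v : Qubits n => v s) (hb t)
    simp only [Matrix.ofLp_toLpLin, Matrix.toLin'_apply, PiLp.smul_apply, smul_eq_mul] at h
    rw [hU, Matrix.of_apply, mul_comm, ← h]
    rfl
  have hUunit : IsUnit U := IsUnit.of_mul_eq_one Uᴴ hUU'
  have hinv : U⁻¹ = Uᴴ := Matrix.inv_eq_right_inv hUU'
  have hH : (-(β : ℂ)) • H = U * (Matrix.diagonal fun t => -(β : ℂ) * (E t : ℂ)) * U⁻¹ := by
    have : (Matrix.diagonal fun t => -(β : ℂ) * (E t : ℂ)) =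
        (-(β : ℂ)) • Matrix.diagonal fun t => (E t : ℂ) := by
      rw [← Matrix.diagonal_smul]; rfl
    rw [this, mul_smul_comm, ← hHU, smul_mul_assoc, mul_assoc, hinv, hUU', mul_one]
  rw [partitionFunction, hH, Matrix.exp_conj _ _ hUunit, Matrix.trace_mul_comm, ← mul_assoc,
    hinv, hUU, one_mul, Matrix.exp_diagonal, Matrix.trace_diagonal]
  push_cast
  refine Finset.sum_congr rfl fun t _ => ?_
  rw [Pi.coe_exp, ← Complex.exp_eq_exp_ℂ]

/-! ### Time reversal -/

/-- The configuration with all spins flipped. -/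
def flipConfig {n : ℕ} (s : Config n) : Config n := fun j => 1 - s j

theorem spinSign_flip (a : Fin 2) : spinSign (1 - a) = -spinSign a := by
  fin_cases a <;> norm_num [spinSign]

/-- The total spin `∑ⱼ σⱼᶻ` of a computational basis state. -/
noncomputable def totalSpin {n : ℕ} (s : Config n) : ℝ := ∑ j, spinSign (s j)

theorem totalSpin_flipConfig {n : ℕ} (s : Config n) : totalSpin (flipConfig s) = -totalSpin s := by
  simp [totalSpin, flipConfig, spinSign_flip]

theorem siteOp_pauliZ_eq_diagonal {n : ℕ} (j : Fin n) :
    siteOp pauliZ j = Matrix.diagonal fun s : Config n => (spinSign (s j) : ℂ) := by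
  have hZ : pauliZ = Matrix.diagonal fun a => (spinSign a : ℂ) := by
    ext a b; fin_cases a <;> fin_cases b <;> simp [pauliZ, spinSign]
  ext s t
  rw [siteOp, tensorOp, Matrix.of_apply, Matrix.diagonal_apply]
  split_ifs with h
  · subst h
    rw [Finset.prod_eq_single j]
    · simp [hZ]
    · intro i _ hi
      simp [hi]
    · simp
  · obtain ⟨i, hi⟩ := Function.ne_iff.1 h
    refine Finset.prod_eq_zero (Finset.mem_univ i) ?_
    by_cases hij : i = j
    · subst hij; simp [hZ, hi]
    · simp [hij, hi]

theorem spinZ_apply {n : ℕ} (ψ : Qubits n) (s : Config n) :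
    Matrix.toEuclideanLin (spinZ n) ψ s = (totalSpin s : ℂ) * ψ s := by
  have : spinZ n = Matrix.diagonal fun s : Config n => (totalSpin s : ℂ) := by
    simp_rw [spinZ, siteOp_pauliZ_eq_diagonal, totalSpin]
    ext s t
    rw [Matrix.sum_apply, Matrix.diagonal_apply]
    by_cases h : s = t <;> simp [h]
  rw [this, Matrix.ofLp_toLpLin, Matrix.toLin'_apply, Matrix.mulVec_diagonal]

theorem HasSpinZ.eq_zero_of_ne {n : ℕ} {ψ : Qubits n} {m : ℝ} (h : HasSpinZ ψ m) {s : Config n}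
    (hs : totalSpin s ≠ m) : ψ s = 0 := by
  have h1 := congrArg (fun v : Qubits n => v s) h
  simp only [spinZ_apply, PiLp.smul_apply, smul_eq_mul] at h1
  have h2 : ((totalSpin s : ℂ) - m) * ψ s = 0 := by rw [sub_mul, h1, sub_self]
  exact (mul_eq_zero.1 h2).resolve_left (sub_ne_zero.2 (by exact_mod_cast hs))

/-- As `-iσʸ` exchanges up and down with signs, time reversal flips all spins, up to a sign, and
conjugates the amplitudes. -/
theorem timeReversal_apply {n : ℕ} (ψ : Qubits n) (s : Config n) :
    timeReversal ψ s = (∏ j, -(spinSign (s j) : ℂ)) * starRingEnd ℂ (ψ (flipConfig s)) := by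
  have hY : ∀ a b : Fin 2, (-Complex.I • pauliY) a b =
      if b = 1 - a then -(spinSign a : ℂ) else 0 := by
    intro a b; fin_cases a <;> fin_cases b <;> simp [pauliY, spinSign]
  rw [timeReversal, Matrix.ofLp_toLpLin, Matrix.toLin'_apply, Matrix.mulVec, dotProduct,
    Finset.sum_eq_single (flipConfig s)]
  · simp [tensorOp, hY, flipConfig]
  · intro t _ ht
    obtain ⟨j, hj⟩ := Function.ne_iff.1 ht
    rw [tensorOp, Matrix.of_apply, Finset.prod_eq_zero (Finset.mem_univ j), zero_mul]
    rw [hY]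
    exact if_neg hj
  · simp

theorem norm_timeReversal {n : ℕ} (ψ : Qubits n) : ‖timeReversal ψ‖ = ‖ψ‖ := by
  rw [EuclideanSpace.norm_eq, EuclideanSpace.norm_eq]
  congr 1
  have hinv : Function.Involutive (flipConfig (n := n)) := fun s => by
    funext j; simp [flipConfig]
  rw [← Equiv.sum_comp hinv.toPerm fun s => ‖ψ s‖ ^ 2]
  refine Finset.sum_congr rfl fun s _ => ?_
  have h1 : ‖∏ j, -(spinSign (s j) : ℂ)‖ = 1 := by
    rw [norm_prod]
    refine Finset.prod_eq_one fun j _ => ?_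
    rw [spinSign]; split_ifs <;> simp
  rw [timeReversal_apply, norm_mul, h1, one_mul, RCLike.norm_conj]
  rfl

theorem concurrence_eq_zero {n : ℕ} {ψ : Qubits n} (h : ∀ s, ψ s = 0 ∨ ψ (flipConfig s) = 0) :
    concurrence ψ = 0 := by
  rw [concurrence, PiLp.inner_apply, Finset.sum_eq_zero, norm_zero]
  intro s _
  rw [timeReversal_apply]
  rcases h s with h | h <;> simp [h]

theorem HasSpinZ.concurrence_eq_zero {n : ℕ} {ψ : Qubits n} {m : ℝ} (h : HasSpinZ ψ m)
    (hm : m ≠ 0) : concurrence ψ = 0 := by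
  refine XXChain.concurrence_eq_zero fun s => ?_
  by_cases hs : totalSpin s = m
  · right
    refine h.eq_zero_of_ne ?_
    rw [totalSpin_flipConfig, hs]
    intro h'
    exact hm (by linarith)
  · exact Or.inl (h.eq_zero_of_ne hs)

/-- A one-qubit operator that changes sign under the time reversal of its qubit changes sign under
time reversal of the whole chain. -/
theorem siteOp_mul_timeReversal {n : ℕ} {A : Matrix (Fin 2) (Fin 2) ℂ}
    (hA : A * (-Complex.I • pauliY) = -((-Complex.I • pauliY) * A.map (starRingEnd ℂ)))
    (j : Fin n) :
    siteOp A j * tensorOp (fun _ : Fin n => -Complex.I • pauliY) =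
      -(tensorOp (fun _ : Fin n => -Complex.I • pauliY) * (siteOp A j).map (starRingEnd ℂ)) := by
  have key : siteOp A j * tensorOp (fun _ : Fin n => -Complex.I • pauliY) =
      (∏ m, (Pi.mulSingle j (-1) : Fin n → ℂ) m) •
        (tensorOp (fun _ : Fin n => -Complex.I • pauliY) *
          (siteOp A j).map (starRingEnd ℂ)) := by
    simp only [siteOp, tensorOp_map_conj, tensorOp_mul]
    rw [← tensorOp_smul]
    congr 1
    funext m
    by_cases hm : m = j
    · subst hm; simpa using hA
    · simp [hm]
  rw [key, Finset.prod_pi_mulSingle']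
  simp

/-- Each Pauli operator changes sign under time reversal, so the couplings are invariant. -/
theorem hamiltonian_mul_timeReversal (n : ℕ) (J : ℝ) :
    hamiltonian n J 0 * tensorOp (fun _ : Fin n => -Complex.I • pauliY) =
      tensorOp (fun _ : Fin n => -Complex.I • pauliY) *
        (hamiltonian n J 0).map (starRingEnd ℂ) := by
  have hX' : pauliX.map (starRingEnd ℂ) = pauliX := by
    ext a b; fin_cases a <;> fin_cases b <;> simp [pauliX]
  have hY' : pauliY.map (starRingEnd ℂ) = -pauliY := by
    ext a b; fin_cases a <;> fin_cases b <;> simp [pauliY]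
  have hX : ∀ j : Fin n, _ := siteOp_mul_timeReversal (n := n) (A := pauliX) (by
    rw [hX', mul_smul_comm, smul_mul_assoc, pauliY_mul_pauliX, smul_neg, neg_neg])
  have hY : ∀ j : Fin n, _ := siteOp_mul_timeReversal (n := n) (A := pauliY) (by
    rw [hY', mul_smul_comm, smul_mul_assoc, mul_neg, smul_neg, neg_neg])
  simp only [hamiltonian, Complex.ofReal_zero, zero_smul, add_zero]
  generalize tensorOp (fun _ : Fin n => -Complex.I • pauliY) = T at *
  have hmap : ∀ M : Op n, M.map (starRingEnd ℂ) = (starRingEnd ℂ).mapMatrix M := fun _ => rfl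
  have hsmul : ∀ M : Op n, (starRingEnd ℂ).mapMatrix ((J : ℂ) • M) =
      (J : ℂ) • (starRingEnd ℂ).mapMatrix M := fun M => by ext; simp
  simp only [hmap] at hX hY ⊢
  have hcomm : ∀ x y : Op n, x * T = -(T * (starRingEnd ℂ).mapMatrix x) →
      y * T = -(T * (starRingEnd ℂ).mapMatrix y) →
      x * y * T = T * ((starRingEnd ℂ).mapMatrix x * (starRingEnd ℂ).mapMatrix y) := by
    intro x y hx hy
    rw [mul_assoc, hy, mul_neg, ← mul_assoc, hx, neg_mul, neg_neg, mul_assoc]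
  rw [map_sum, Finset.sum_mul, Finset.mul_sum]
  refine Finset.sum_congr rfl fun j _ => ?_
  rw [hsmul, smul_mul_assoc, mul_smul_comm, map_add, map_mul, map_mul, add_mul, mul_add,
    hcomm _ _ (hX _) (hX _), hcomm _ _ (hY _) (hY _)]

theorem hamiltonian_timeReversal {n : ℕ} {J : ℝ} {ψ : Qubits n} {e : ℝ}
    (h : Matrix.toEuclideanLin (hamiltonian n J 0) ψ = (e : ℂ) • ψ) :
    Matrix.toEuclideanLin (hamiltonian n J 0) (timeReversal ψ) = (e : ℂ) • timeReversal ψ := by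
  have h1 : (hamiltonian n J 0).map (starRingEnd ℂ) *ᵥ (fun s => starRingEnd ℂ (ψ s)) =
      (e : ℂ) • fun s => starRingEnd ℂ (ψ s) := by
    funext s
    have := congrArg (fun v : Qubits n => starRingEnd ℂ (v s)) h
    simpa [Matrix.ofLp_toLpLin, Matrix.toLin'_apply, Matrix.mulVec, dotProduct] using this
  rw [timeReversal, Matrix.toLpLin_toLp, Matrix.toLpLin_toLp, Matrix.toLin'_apply,
    Matrix.toLin'_apply, Matrix.mulVec_mulVec, hamiltonian_mul_timeReversal,
    ← Matrix.mulVec_mulVec, h1, Matrix.mulVec_smul, WithLp.toLp_smul]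

/-! ### Minimal configurations of the modes -/

/-- The configuration `t` of the modes has least energy: every mode with positive single-mode energy
is down and every mode with negative single-mode energy is up. -/
def IsMinimal {n : ℕ} (c : Fin n → ℝ) (t : Config n) : Prop := ∀ k, c k * spinSign (t k) ≤ 0

theorem IsMinimal.mul_spinSign_le {n : ℕ} {c : Fin n → ℝ} {t₀ : Config n} (h : IsMinimal c t₀)
    (t : Config n) (k : Fin n) : c k * spinSign (t₀ k) ≤ c k * spinSign (t k) := by
  have := h k
  unfold spinSign at *
  split_ifs at * <;> linarith

theorem IsMinimal.modeEnergy_le {n : ℕ} {c : Fin n → ℝ} {t₀ : Config n} (h : IsMinimal c t₀)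
    (t : Config n) : modeEnergy c t₀ ≤ modeEnergy c t :=
  Finset.sum_le_sum fun k _ => h.mul_spinSign_le t k

theorem IsMinimal.modeEnergy_eq_iff {n : ℕ} {c : Fin n → ℝ} {t₀ : Config n} (h : IsMinimal c t₀)
    (t : Config n) : modeEnergy c t = modeEnergy c t₀ ↔ IsMinimal c t := by
  constructor
  · intro ht k
    have := (Finset.sum_eq_sum_iff_of_le fun k _ => h.mul_spinSign_le t k).1 ht.symm k
      (Finset.mem_univ k)
    rw [← this]
    exact h k
  · exact fun ht => le_antisymm (ht.modeEnergy_le t₀) (h.modeEnergy_le t)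

theorem IsMinimal.apply_eq {n : ℕ} {c : Fin n → ℝ} {s t : Config n} (hs : IsMinimal c s)
    (ht : IsMinimal c t) {k : Fin n} (hk : c k ≠ 0) : s k = t k := by
  have h1 := hs k
  have h2 := ht k
  apply spinSign_injective
  unfold spinSign at *
  by_contra h
  split_ifs at * <;> first | exact h rfl | exact hk (by linarith)

theorem IsMinimal.iff_eq_of_ne_zero {n : ℕ} {c : Fin n → ℝ} {t₀ : Config n} (h : IsMinimal c t₀)
    (hc : ∀ k, c k ≠ 0) (t : Config n) : IsMinimal c t ↔ t = t₀ :=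
  ⟨fun ht => funext fun k => ht.apply_eq h (hc k), fun ht => ht ▸ h⟩

/-- A single mode of energy zero may be flipped at no cost. -/
theorem IsMinimal.iff_eq_or_eq_update {n : ℕ} {c : Fin n → ℝ} {t₀ : Config n}
    (h : IsMinimal c t₀) {q : Fin n} (hq : c q = 0) (hc : ∀ k, k ≠ q → c k ≠ 0) (t : Config n) :
    IsMinimal c t ↔ t = t₀ ∨ t = Function.update t₀ q (1 - t₀ q) := by
  constructor
  · intro ht
    have h2 : ∀ a b : Fin 2, a = b ∨ a = 1 - b := by decide
    rcases h2 (t q) (t₀ q) with hh | hh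
    · left
      funext k
      by_cases hk : k = q
      · rw [hk, hh]
      · exact ht.apply_eq h (hc k hk)
    · right
      funext k
      by_cases hk : k = q
      · subst hk; simp [hh]
      · rw [Function.update_of_ne hk]
        exact ht.apply_eq h (hc k hk)
  · rintro (rfl | rfl) k
    · exact h k
    · by_cases hk : k = q
      · subst hk; simp [hq]
      · rw [Function.update_of_ne hk]
        exact h k

theorem modeEnergy_one_update {n : ℕ} (t : Config n) (q : Fin n) :
    modeEnergy 1 (Function.update t q (1 - t q)) = modeEnergy 1 t - 2 * spinSign (t q) := by
  rw [modeEnergy, modeEnergy, ← Finset.add_sum_erase _ _ (Finset.mem_univ q),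
    ← Finset.add_sum_erase Finset.univ (fun k => (1 : Fin n → ℝ) k * spinSign (t k))
      (Finset.mem_univ q)]
  rw [Finset.sum_congr rfl fun k hk => by rw [Function.update_of_ne (Finset.ne_of_mem_erase hk)]]
  simp only [Function.update_self, spinSign_flip, Pi.one_apply]
  ring

/-- The half-filled configuration of the modes: for even `n`, exactly those with `cos θₖ > 0` are
down. -/
def halfFilling (n : ℕ) : Config n := fun k => if (k : ℕ) < n / 2 then 1 else 0

theorem spinSign_halfFilling {n : ℕ} (k : Fin n) :
    spinSign (halfFilling n k) = if (k : ℕ) < n / 2 then -1 else 1 := by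
  unfold spinSign halfFilling
  split_ifs <;> simp_all

theorem sum_halfFilling {n : ℕ} (hn : Even n) {f : ℕ → ℝ}
    (hf : ∀ k < n, f (n - 1 - k) = -f k) :
    ∑ k : Fin n, f k * spinSign (halfFilling n k) = -2 * ∑ k ∈ Finset.range (n / 2), f k := by
  obtain ⟨p, rfl⟩ := hn
  have hp : (p + p) / 2 = p := by omega
  simp only [spinSign_halfFilling, hp]
  have h1 : ∑ k ∈ Finset.range p, f k * (if k < p then -1 else 1) =
      -∑ k ∈ Finset.range p, f k := by
    rw [← Finset.sum_neg_distrib]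
    refine Finset.sum_congr rfl fun k hk => ?_
    rw [if_pos (Finset.mem_range.1 hk)]
    ring
  have h2 : ∑ k ∈ Finset.range p, f (p + k) * (if p + k < p then -1 else 1) =
      -∑ k ∈ Finset.range p, f k := by
    rw [← Finset.sum_neg_distrib, ← Finset.sum_range_reflect]
    refine Finset.sum_congr rfl fun k hk => ?_
    have := Finset.mem_range.1 hk
    rw [if_neg (by omega), ← hf k (by omega), mul_one]
    congr 1
    omega
  rw [Fin.sum_univ_eq_sum_range (fun k => f k * if k < p then -1 else 1) (p + p),
    Finset.sum_range_add, h1, h2]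
  ring

theorem modeEnergy_one_halfFilling {n : ℕ} (hn : Even n) : modeEnergy 1 (halfFilling n) = 0 := by
  obtain ⟨p, rfl⟩ := hn
  have hp : (p + p) / 2 = p := by omega
  simp only [modeEnergy, Pi.one_apply, one_mul, spinSign_halfFilling, hp]
  simp [Fin.sum_univ_add]

/-- If all modes with `cos θₖ > 0` and the next one are down, more than half of the modes are
down. -/
theorem modeEnergy_one_neg {n : ℕ} (hn : Even n) {t : Config n}
    (ht : ∀ k : Fin n, (k : ℕ) ≤ n / 2 → spinSign (t k) = -1) (hpos : 0 < n) :
    modeEnergy 1 t < 0 := by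
  rw [← modeEnergy_one_halfFilling hn]
  refine Finset.sum_lt_sum (fun k _ => ?_) ⟨⟨n / 2, by omega⟩, Finset.mem_univ _, ?_⟩
  · rw [spinSign_halfFilling]
    simp only [Pi.one_apply, one_mul]
    split_ifs with h
    · exact (ht k h.le).le
    · unfold spinSign; split_ifs <;> norm_num
  · rw [spinSign_halfFilling, ht _ le_rfl]
    norm_num

theorem modeEnergy_one_pos {n : ℕ} (hn : Even n) {t : Config n}
    (ht : ∀ k : Fin n, n / 2 ≤ (k : ℕ) + 1 → spinSign (t k) = 1) (hpos : 0 < n) :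
    0 < modeEnergy 1 t := by
  have h2 : 2 ≤ n := by obtain ⟨p, rfl⟩ := hn; omega
  rw [← modeEnergy_one_halfFilling hn]
  refine Finset.sum_lt_sum (fun k _ => ?_) ⟨⟨n / 2 - 1, by omega⟩, Finset.mem_univ _, ?_⟩
  · rw [spinSign_halfFilling]
    simp only [Pi.one_apply, one_mul]
    split_ifs with h
    · unfold spinSign; split_ifs <;> norm_num
    · exact (ht k (by omega)).ge
  · rw [spinSign_halfFilling, ht _ (by simp only; omega), if_pos (by simp only; omega)]
    norm_num

/-! ### The single-mode energies and the critical field -/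

/-- With `k` counted from zero, `n / 2` is the first mode with `cos θₖ < 0`. -/
theorem two_mul_cos_half {n : ℕ} (hn : Even n) (J : ℝ) :
    2 * J * Real.cos (momentum n (n / 2)) = -hCrit n J := by
  obtain ⟨p, rfl⟩ := hn
  have hp : (p + p) / 2 = p := by omega
  have hne : ((p + p : ℕ) : ℝ) + 1 ≠ 0 := by positivity
  have : momentum (p + p) p = Real.pi / (2 * (((p + p : ℕ) : ℝ) + 1)) + Real.pi / 2 := by
    rw [momentum]
    push_cast at hne ⊢
    field_simp
    ring
  rw [hp, this, Real.cos_add_pi_div_two, hCrit]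
  ring

theorem two_mul_cos_half_sub_one {n : ℕ} (hn : Even n) (hpos : 0 < n) (J : ℝ) :
    2 * J * Real.cos (momentum n (n / 2 - 1)) = hCrit n J := by
  have h := cos_momentum_rev n ⟨n / 2, by omega⟩
  have hi : n - (n / 2 + 1) = n / 2 - 1 := by obtain ⟨p, rfl⟩ := hn; omega
  rw [Fin.val_rev] at h
  simp only [hi] at h
  rw [h, mul_neg, two_mul_cos_half hn, neg_neg]

theorem hCrit_pos {n : ℕ} (hpos : 0 < n) {J : ℝ} (hJ : 0 < J) : 0 < hCrit n J := by
  have hn : (1 : ℝ) ≤ n := by exact_mod_cast hpos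
  refine mul_pos (by positivity) (Real.sin_pos_of_pos_of_lt_pi (by positivity) ?_)
  rw [div_lt_iff₀ (by positivity)]
  nlinarith [Real.pi_pos]

theorem two_mul_cos_anti {n : ℕ} {J : ℝ} (hJ : 0 < J) {k l : ℕ} (hl : l < n) (h : k < l) :
    2 * J * Real.cos (momentum n l) < 2 * J * Real.cos (momentum n k) :=
  mul_lt_mul_of_pos_left (cos_momentum_strictAnti n hl h) (by positivity)

theorem hCrit_lt {n : ℕ} (hn : Even n) (hpos : 0 < n) {J : ℝ} (hJ : 0 < J) {k : ℕ}
    (hk : k + 1 < n / 2) : hCrit n J < 2 * J * Real.cos (momentum n k) := by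
  rw [← two_mul_cos_half_sub_one hn hpos]
  exact two_mul_cos_anti hJ (by omega) (by omega)

theorem hCrit_le {n : ℕ} (hn : Even n) (hpos : 0 < n) {J : ℝ} (hJ : 0 < J) {k : ℕ}
    (hk : k < n / 2) : hCrit n J ≤ 2 * J * Real.cos (momentum n k) := by
  rcases (Nat.succ_le_of_lt hk).lt_or_eq with h | h
  · exact (hCrit_lt hn hpos hJ h).le
  · rw [← two_mul_cos_half_sub_one hn hpos, ← h]; simp

theorem lt_neg_hCrit {n : ℕ} (hn : Even n) {J : ℝ} (hJ : 0 < J) {k : ℕ}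
    (hkn : k < n) (hk : n / 2 < k) : 2 * J * Real.cos (momentum n k) < -hCrit n J := by
  rw [← two_mul_cos_half hn]
  exact two_mul_cos_anti hJ hkn hk

theorem le_neg_hCrit {n : ℕ} (hn : Even n) {J : ℝ} (hJ : 0 < J) {k : ℕ}
    (hkn : k < n) (hk : n / 2 ≤ k) : 2 * J * Real.cos (momentum n k) ≤ -hCrit n J := by
  rcases hk.lt_or_eq with h | h
  · exact (lt_neg_hCrit hn hJ hkn h).le
  · rw [← two_mul_cos_half hn, h]

theorem isMinimal_halfFilling {n : ℕ} (hn : Even n) (hpos : 0 < n) {J h : ℝ} (hJ : 0 < J)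
    (hh : |h| ≤ hCrit n J) : IsMinimal (modeField n J h) (halfFilling n) := by
  intro k
  obtain ⟨h1, h2⟩ := abs_le.1 hh
  rw [spinSign_halfFilling, modeField]
  split_ifs with hk
  · linarith [hCrit_le hn hpos hJ hk]
  · linarith [le_neg_hCrit hn hJ k.2 (not_lt.1 hk)]

theorem modeField_ne_zero {n : ℕ} (hn : Even n) (hpos : 0 < n) {J h : ℝ} (hJ : 0 < J)
    (hh : |h| < hCrit n J) (k : Fin n) : modeField n J h k ≠ 0 := by
  obtain ⟨h1, h2⟩ := abs_lt.1 hh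
  rw [modeField]
  by_cases hk : (k : ℕ) < n / 2
  · linarith [hCrit_le hn hpos hJ hk]
  · linarith [le_neg_hCrit hn hJ k.2 (not_lt.1 hk)]

/-- At the critical field exactly one mode has energy zero: the first one above half filling if
`h > 0`, the last one below if `h < 0`. Flipping it changes the spin by `-2 sgn h`. -/
theorem exists_zero_mode {n : ℕ} (hn : Even n) (hpos : 0 < n) {J h : ℝ} (hJ : 0 < J)
    (hh : |h| = hCrit n J) : ∃ q : Fin n, modeField n J h q = 0 ∧
      (∀ k, k ≠ q → modeField n J h k ≠ 0) ∧ spinSign (halfFilling n q) = Real.sign h := by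
  have hc := hCrit_pos hpos hJ
  have hn2 : 2 ≤ n := by obtain ⟨p, rfl⟩ := hn; omega
  rcases abs_cases h with ⟨ha, h0⟩ | ⟨ha, h0⟩
  · refine ⟨⟨n / 2, by omega⟩, ?_, fun k hk => ?_, ?_⟩
    · rw [modeField, two_mul_cos_half hn]; linarith
    · rw [modeField]
      rcases lt_trichotomy (k : ℕ) (n / 2) with hlt | heq | hgt
      · linarith [hCrit_le hn hpos hJ hlt]
      · exact absurd (Fin.ext heq) hk
      · linarith [lt_neg_hCrit hn hJ k.2 hgt]
    · rw [spinSign_halfFilling, if_neg (lt_irrefl _), Real.sign_of_pos (by linarith)]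
  · refine ⟨⟨n / 2 - 1, by omega⟩, ?_, fun k hk => ?_, ?_⟩
    · rw [modeField, two_mul_cos_half_sub_one hn hpos]; linarith
    · rw [modeField]
      rcases lt_trichotomy (k : ℕ) (n / 2 - 1) with hlt | heq | hgt
      · linarith [hCrit_lt hn hpos hJ (show (k : ℕ) + 1 < n / 2 by omega)]
      · exact absurd (Fin.ext heq) hk
      · linarith [le_neg_hCrit hn hJ k.2 (show n / 2 ≤ (k : ℕ) by omega)]
    · rw [spinSign_halfFilling, if_pos (by simp only; omega), Real.sign_of_neg h0]

/-- From the critical field on there is a minimal configuration with nonzero spin. -/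
theorem exists_isMinimal_spin_ne_zero {n : ℕ} (hn : Even n) (hpos : 0 < n) {J h : ℝ}
    (hJ : 0 < J) (hh : hCrit n J ≤ |h|) :
    ∃ t, IsMinimal (modeField n J h) t ∧ modeEnergy 1 t ≠ 0 := by
  -- a mode of energy zero, if any, gets the sign opposite to `h`
  rcases abs_cases h with ⟨ha, h0⟩ | ⟨ha, h0⟩
  · refine ⟨fun k => if modeField n J h k < 0 then 0 else 1, fun k => ?_,
      (modeEnergy_one_neg hn (fun k hk => ?_) hpos).ne⟩
    · unfold spinSign
      split_ifs <;> simp_all [le_of_lt]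
    · have : ¬ modeField n J h k < 0 := by
        rw [modeField]
        rcases hk.lt_or_eq with hk | hk
        · linarith [hCrit_le hn hpos hJ hk, hCrit_pos hpos hJ]
        · rw [hk, two_mul_cos_half hn]; linarith
      simp [spinSign, this]
  · refine ⟨fun k => if modeField n J h k ≤ 0 then 0 else 1, fun k => ?_,
      (modeEnergy_one_pos hn (fun k hk => ?_) hpos).ne'⟩
    · unfold spinSign
      split_ifs <;> simp_all [le_of_lt]
    · have : modeField n J h k ≤ 0 := by
        rw [modeField]
        by_cases hk' : (k : ℕ) < n / 2
        · rw [show (k : ℕ) = n / 2 - 1 by omega, two_mul_cos_half_sub_one hn hpos]; linarith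
        · linarith [le_neg_hCrit hn hJ k.2 (not_lt.1 hk'), hCrit_pos hpos hJ]
      simp [spinSign, this]

/-- Beyond the critical field all minimal configurations have spin of the sign opposite to `h`. -/
theorem IsMinimal.mul_modeEnergy_one_neg {n : ℕ} (hn : Even n) (hpos : 0 < n) {J h : ℝ}
    (hJ : 0 < J) (hh : hCrit n J < |h|) {t : Config n} (ht : IsMinimal (modeField n J h) t) :
    h * modeEnergy 1 t < 0 := by
  have hc := hCrit_pos hpos hJ
  rcases abs_cases h with ⟨ha, h0⟩ | ⟨ha, h0⟩
  · refine mul_neg_of_pos_of_neg (by linarith) (modeEnergy_one_neg hn (fun k hk => ?_) hpos)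
    have hk' : 0 < modeField n J h k := by
      rw [modeField]
      rcases hk.lt_or_eq with hk | hk
      · linarith [hCrit_le hn hpos hJ hk]
      · rw [hk, two_mul_cos_half hn]; linarith
    have := ht k
    unfold spinSign at *
    split_ifs at * <;> linarith
  · refine mul_neg_of_neg_of_pos h0 (modeEnergy_one_pos hn (fun k hk => ?_) hpos)
    have hk' : modeField n J h k < 0 := by
      rw [modeField]
      by_cases hk' : (k : ℕ) < n / 2
      · rw [show (k : ℕ) = n / 2 - 1 by omega, two_mul_cos_half_sub_one hn hpos]; linarith
      · linarith [le_neg_hCrit hn hJ k.2 (not_lt.1 hk')]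
    have := ht k
    unfold spinSign at *
    split_ifs at * <;> linarith

/-! ### The closed form of the ground state energy and the partition function -/

theorem modeEnergy_halfFilling {n : ℕ} (hn : Even n) (J : ℝ) :
    modeEnergy (modeField n J 0) (halfFilling n) =
      -4 * J * ∑ k ∈ Finset.Icc 1 (n / 2), Real.cos (Real.pi * k / (n + 1)) := by
  have hrev : ∀ k < n, 2 * J * Real.cos (momentum n (n - 1 - k)) =
      -(2 * J * Real.cos (momentum n k)) := by
    intro k hk
    have h := cos_momentum_rev n ⟨k, hk⟩
    rw [Fin.val_rev] at h
    rw [show n - 1 - k = n - (k + 1) by omega, h]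
    ring
  have h1 : Finset.Icc 1 (n / 2) = Finset.Ico (0 + 1) (n / 2 + 1) := by
    ext k; simp only [Finset.mem_Icc, Finset.mem_Ico]; omega
  have h2 := sum_halfFilling hn (f := fun k => 2 * J * Real.cos (momentum n k)) hrev
  simp only [modeEnergy, modeField, zero_add]
  rw [h2, h1, ← Finset.sum_Ico_add', ← Finset.range_eq_Ico, ← Finset.mul_sum]
  simp only [momentum]
  ring

theorem sum_cos_mul_sin (x : ℝ) (m : ℕ) :
    (1 + ∑ k ∈ Finset.Icc 1 m, Real.cos (k * x)) * Real.sin (x / 2) =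
      Real.cos (m * x / 2) * Real.sin ((m + 1) * x / 2) := by
  have key : ∀ m : ℕ, 2 * (1 + ∑ k ∈ Finset.Icc 1 m, Real.cos (k * x)) * Real.sin (x / 2) =
      Real.sin (m * x + x / 2) + Real.sin (x / 2) := by
    intro m
    induction m with
    | zero => simp; ring
    | succ m ih =>
      rw [Finset.sum_Icc_succ_top (by omega)]
      have e1 : (m : ℝ) * x + x / 2 = ((m + 1 : ℕ) : ℝ) * x - x / 2 := by push_cast; ring
      rw [e1, Real.sin_sub] at ih
      rw [Real.sin_add]
      linear_combination ih
  have h := key m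
  have e1 : (m : ℝ) * x + x / 2 = (m + 1) * x / 2 + m * x / 2 := by ring
  have e2 : x / 2 = (m + 1) * x / 2 - m * x / 2 := by ring
  have e3 : Real.sin (x / 2) = Real.sin ((m + 1) * x / 2) * Real.cos (m * x / 2) -
      Real.cos ((m + 1) * x / 2) * Real.sin (m * x / 2) := by
    rw [← Real.sin_sub, ← e2]
  rw [e1, Real.sin_add] at h
  linear_combination h / 2 + e3 / 2

theorem sum_cos_closed_form {n : ℕ} (hn : Even n) (hpos : 0 < n) :
    ∑ k ∈ Finset.Icc 1 (n / 2), Real.cos (Real.pi * k / (n + 1)) =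
      Real.cos (n * Real.pi / (4 * (n + 1))) * (Real.sin (Real.pi / (2 * (n + 1))))⁻¹ *
          Real.sin ((n + 2) * Real.pi / (4 * (n + 1))) - 1 := by
  have hs : Real.sin (Real.pi / (2 * ((n : ℝ) + 1))) ≠ 0 := by
    have h := hCrit_pos hpos one_pos
    rw [hCrit] at h
    exact (pos_of_mul_pos_right h (by norm_num)).ne'
  have h := sum_cos_mul_sin (Real.pi / (n + 1)) (n / 2)
  have hn1 : (n : ℝ) + 1 ≠ 0 := by positivity
  have h2 : ((n / 2 : ℕ) : ℝ) = n / 2 := Nat.cast_div hn.two_dvd (by norm_num)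
  rw [h2, show Real.pi / ((n : ℝ) + 1) / 2 = Real.pi / (2 * (n + 1)) by field_simp,
    show (n : ℝ) / 2 * (Real.pi / (n + 1)) / 2 = n * Real.pi / (4 * (n + 1)) by field_simp; ring,
    show ((n : ℝ) / 2 + 1) * (Real.pi / (n + 1)) / 2 = (n + 2) * Real.pi / (4 * (n + 1)) by
      field_simp; ring,
    Finset.sum_congr rfl fun k _ => by
      rw [show (k : ℝ) * (Real.pi / (n + 1)) = Real.pi * k / (n + 1) by ring]] at h
  rw [eq_sub_iff_add_eq, add_comm, mul_right_comm, ← h, mul_assoc,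
    mul_inv_cancel₀ hs, mul_one]

theorem sum_exp_modeEnergy {n : ℕ} (c : Fin n → ℝ) (β : ℝ) :
    ∑ t, Real.exp (-β * modeEnergy c t) = 2 ^ n * ∏ k, Real.cosh (β * c k) := by
  have h1 : ∀ k, ∑ a : Fin 2, Real.exp (-β * (c k * spinSign a)) = 2 * Real.cosh (β * c k) := by
    intro k
    rw [Fin.sum_univ_two, Real.cosh_eq]
    simp [spinSign]
    ring
  have h2 : ∏ k : Fin n, 2 * Real.cosh (β * c k) = 2 ^ n * ∏ k, Real.cosh (β * c k) := by
    rw [Finset.prod_mul_distrib]; simp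
  rw [← h2, ← Finset.prod_congr rfl fun k _ => h1 k, Finset.prod_univ_sum, Fintype.piFinset_univ]
  refine Finset.sum_congr rfl fun t _ => ?_
  rw [modeEnergy, Finset.mul_sum, Real.exp_sum]

theorem prod_modeField {n : ℕ} (J h : ℝ) (g : ℝ → ℝ) :
    ∏ k : Fin n, g (modeField n J h k) =
      ∏ k ∈ Finset.Icc 1 n, g (h + 2 * J * Real.cos (Real.pi * k / (n + 1))) := by
  have h1 : Finset.Icc 1 n = Finset.Ico (0 + 1) (n + 1) := by
    ext k; simp only [Finset.mem_Icc, Finset.mem_Ico]; omega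
  rw [h1, ← Finset.prod_Ico_add', ← Finset.range_eq_Ico,
    ← Fin.prod_univ_eq_prod_range
      (fun k => g (h + 2 * J * Real.cos (Real.pi * (k + 1 : ℕ) / (n + 1))))]
  rfl

/-! ### Ground states and concurrence -/

/-- If the ground state is unique, time reversal can only change it by a phase. -/
theorem concurrence_eq_one {n : ℕ} {J e : ℝ} {b : OrthonormalBasis (Config n) ℂ (Qubits n)}
    {E : Config n → ℝ} (hb : ∀ t, Matrix.toEuclideanLin (hamiltonian n J 0) (b t) =
      (E t : ℂ) • b t) {t₀ : Config n} (ht₀ : ∀ t, t ≠ t₀ → E t ≠ e) {ψ : Qubits n}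
    (hψ : Matrix.toEuclideanLin (hamiltonian n J 0) ψ = (e : ℂ) • ψ) (h1 : ‖ψ‖ = 1) :
    concurrence ψ = 1 := by
  have hmul : ∀ {φ : Qubits n}, Matrix.toEuclideanLin (hamiltonian n J 0) φ = (e : ℂ) • φ →
      φ = inner ℂ (b t₀) φ • b t₀ := by
    intro φ hφ
    conv_lhs => rw [← b.sum_repr' φ]
    refine Finset.sum_eq_single t₀ (fun t _ ht => ?_) (by simp)
    rw [inner_eigenbasis_eq_zero hb hφ (ht₀ t ht), zero_smul]
  have hnorm : ∀ {φ : Qubits n}, Matrix.toEuclideanLin (hamiltonian n J 0) φ = (e : ℂ) • φ →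
      ‖inner ℂ (b t₀) φ‖ = ‖φ‖ := by
    intro φ hφ
    conv_rhs => rw [hmul hφ, norm_smul, b.norm_eq_one, mul_one]
  have hΘ := hamiltonian_timeReversal hψ
  rw [concurrence, hmul hψ, inner_smul_left, ← hmul hψ, norm_mul, RCLike.norm_conj, hnorm hψ,
    hnorm hΘ, norm_timeReversal, h1, mul_one]

/-- A superposition of eigenstates of `S_z` whose eigenvalues all have the same sign is supported on
computational basis states with total spin of that sign, and its time reversal on the others. -/
theorem concurrence_eq_zero_of_sign {n : ℕ} {b : OrthonormalBasis (Config n) ℂ (Qubits n)}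
    {m : Config n → ℝ} (hb : ∀ t, HasSpinZ (b t) (m t)) {ψ : Qubits n} {σ : ℝ}
    (hψ : ∀ t, inner ℂ (b t) ψ ≠ 0 → σ * m t < 0) : concurrence ψ = 0 := by
  have key : ∀ s, ψ s ≠ 0 → σ * totalSpin s < 0 := by
    intro s hs
    have hsum : ψ s = ∑ t, inner ℂ (b t) ψ * b t s := by
      conv_lhs => rw [← b.sum_repr' ψ]
      simp
    rw [hsum] at hs
    obtain ⟨t, -, ht⟩ := Finset.exists_ne_zero_of_sum_ne_zero hs
    have h1 : totalSpin s = m t := by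
      by_contra h
      exact right_ne_zero_of_mul ht ((hb t).eq_zero_of_ne h)
    rw [h1]
    exact hψ t (left_ne_zero_of_mul ht)
  refine concurrence_eq_zero fun s => ?_
  by_contra! h
  have h1 := key s h.1
  have h2 := key _ h.2
  rw [totalSpin_flipConfig] at h2
  linarith

end XXChain

open XXChain in
theorem mainTheorem4 (n : ℕ) (hn : Even n) (hpos : 0 < n) (J : ℝ) :
    -- the ground state energy at zero field
    (0 ≤ J →
      XXChain.IsGroundEnergy (XXChain.hamiltonian n J 0)
        (-4 * J * ∑ k ∈ Finset.Icc 1 (n / 2), Real.cos (Real.pi * k / (n + 1))) ∧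
      -4 * J * ∑ k ∈ Finset.Icc 1 (n / 2), Real.cos (Real.pi * k / (n + 1)) =
        -4 * J * (Real.cos (n * Real.pi / (4 * (n + 1))) * (Real.sin (Real.pi / (2 * (n + 1))))⁻¹ *
          Real.sin ((n + 2) * Real.pi / (4 * (n + 1))) - 1)) ∧
    -- the ground states and their concurrence as functions of the field
    (0 < J →
      -- at zero field the ground state is unique and has `s_z = 0`
      (XXChain.HasGroundDegeneracy (XXChain.hamiltonian n J 0) 1 ∧
        ∀ ψ, XXChain.IsGroundState (XXChain.hamiltonian n J 0) ψ → XXChain.HasSpinZ ψ 0) ∧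
      -- below the critical field it stays the unique ground state, with concurrence one
      (∀ h : ℝ, |h| < XXChain.hCrit n J →
        XXChain.HasGroundDegeneracy (XXChain.hamiltonian n J h) 1 ∧
        ∀ ψ, XXChain.IsGroundState (XXChain.hamiltonian n J h) ψ →
          XXChain.IsGroundState (XXChain.hamiltonian n J 0) ψ ∧ XXChain.HasSpinZ ψ 0 ∧
            XXChain.concurrence ψ = 1) ∧
      -- at the critical field it becomes degenerate with a state having `s_z = -2 sgn h`
      (∀ h : ℝ, |h| = XXChain.hCrit n J →
        XXChain.HasGroundDegeneracy (XXChain.hamiltonian n J h) 2 ∧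
        (∀ ψ, XXChain.IsGroundState (XXChain.hamiltonian n J 0) ψ →
          XXChain.IsGroundState (XXChain.hamiltonian n J h) ψ) ∧
        ∃ φ, XXChain.IsGroundState (XXChain.hamiltonian n J h) φ ∧
          XXChain.HasSpinZ φ (-2 * Real.sign h) ∧ XXChain.concurrence φ = 0) ∧
      -- from the critical field on, the ground states with `s_z ≠ 0` have concurrence zero
      (∀ h : ℝ, XXChain.hCrit n J ≤ |h| →
        (∃ s : ℝ, s ≠ 0 ∧ ∃ ψ, XXChain.IsGroundState (XXChain.hamiltonian n J h) ψ ∧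
          XXChain.HasSpinZ ψ s) ∧
        ∀ (s : ℝ) (ψ : XXChain.Qubits n), s ≠ 0 →
          XXChain.IsGroundState (XXChain.hamiltonian n J h) ψ → XXChain.HasSpinZ ψ s →
            XXChain.concurrence ψ = 0) ∧
      -- beyond the critical field, every ground state has concurrence zero, and none has `s_z = 0`
      (∀ h : ℝ, XXChain.hCrit n J < |h| →
        ∀ ψ, XXChain.IsGroundState (XXChain.hamiltonian n J h) ψ →
          XXChain.concurrence ψ = 0 ∧ ¬ XXChain.HasSpinZ ψ 0)) ∧
    -- the partition function
    (∀ β h : ℝ, XXChain.partitionFunction (XXChain.hamiltonian n J h) β =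
      ((2 ^ n * ∏ k ∈ Finset.Icc 1 n,
        Real.cosh (β * (h + 2 * J * Real.cos (Real.pi * k / (n + 1)))) : ℝ) : ℂ)) := by
  obtain ⟨b, hbH, hbS⟩ := exists_eigenbasis n
  -- the ground space of `H(h)` is spanned by the `b t` with `t` minimal
  have hdeg : ∀ (J h : ℝ) (t₀ : Config n) (s : Finset (Config n)),
      IsMinimal (modeField n J h) t₀ → (∀ t, t ∈ s ↔ IsMinimal (modeField n J h) t) →
      HasGroundDegeneracy (hamiltonian n J h) s.card := fun J h t₀ s ht₀ hs =>
    ⟨_, isGroundEnergy_of_forall_le (hbH J h) ht₀.modeEnergy_le,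
      finrank_eigenspace_eq_card (hbH J h) _ s fun t => by rw [hs, ht₀.modeEnergy_eq_iff]⟩
  have hgs : ∀ (J h : ℝ) (t₀ : Config n) (ψ : Qubits n), IsMinimal (modeField n J h) t₀ →
      (IsGroundState (hamiltonian n J h) ψ ↔
        ‖ψ‖ = 1 ∧ ∀ t, ¬ IsMinimal (modeField n J h) t → inner ℂ (b t) ψ = 0) :=
    fun J h t₀ ψ ht₀ => by
      simp_rw [isGroundState_iff (hbH J h) ht₀.modeEnergy_le, ne_eq, ht₀.modeEnergy_eq_iff]
  have hbgs : ∀ (J h : ℝ) (t : Config n), IsMinimal (modeField n J h) t →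
      IsGroundState (hamiltonian n J h) (b t) := fun J h t ht =>
    (hgs J h t (b t) ht).2 ⟨b.norm_eq_one t, fun s hs => by
      rw [b.inner_eq_ite, if_neg]
      rintro rfl
      exact hs ht⟩
  refine ⟨fun hJ => ⟨?_, by rw [sum_cos_closed_form hn hpos]⟩, fun hJ => ?_, fun β h => ?_⟩
  · rw [← modeEnergy_halfFilling hn]
    refine isGroundEnergy_of_forall_le (hbH J 0) (IsMinimal.modeEnergy_le ?_)
    rcases hJ.lt_or_eq with hJ | rfl
    · exact isMinimal_halfFilling hn hpos hJ (by simpa using (hCrit_pos hpos hJ).le)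
    -- for `J = 0` every configuration is minimal
    · intro k
      simp [modeField]
  · have hc := hCrit_pos hpos hJ
    have h0 : |(0 : ℝ)| < hCrit n J := by simpa using hc
    have hmin : ∀ h : ℝ, |h| < hCrit n J → ∀ t, IsMinimal (modeField n J h) t ↔
        t = halfFilling n := fun h hh =>
      (isMinimal_halfFilling hn hpos hJ hh.le).iff_eq_of_ne_zero (modeField_ne_zero hn hpos hJ hh)
    have hbelow : ∀ h : ℝ, |h| < hCrit n J →
        HasGroundDegeneracy (hamiltonian n J h) 1 ∧
        ∀ ψ, IsGroundState (hamiltonian n J h) ψ →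
          IsGroundState (hamiltonian n J 0) ψ ∧ HasSpinZ ψ 0 ∧ concurrence ψ = 1 := by
      intro h hh
      have hm := isMinimal_halfFilling hn hpos hJ hh.le
      have hm0 := isMinimal_halfFilling hn hpos hJ h0.le
      refine ⟨?_, fun ψ hψ => ?_⟩
      · simpa using hdeg J h _ {halfFilling n} hm fun t => by
          rw [Finset.mem_singleton, hmin h hh]
      · rw [hgs J h _ ψ hm] at hψ
        simp_rw [hmin h hh] at hψ
        have hψ0 : IsGroundState (hamiltonian n J 0) ψ := by
          rw [hgs J 0 _ ψ hm0]
          simpa only [hmin 0 h0] using hψ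
        refine ⟨hψ0, toEuclideanLin_eq_smul hbS fun t ht => hψ.2 t ?_, ?_⟩
        · rintro rfl
          exact ht (modeEnergy_one_halfFilling hn)
        · refine concurrence_eq_one (hbH J 0) (t₀ := halfFilling n)
            (e := modeEnergy (modeField n J 0) (halfFilling n)) (fun t ht => ?_)
            (toEuclideanLin_eq_smul (hbH J 0) fun t ht => hψ.2 t ?_) hψ.1
          · rwa [ne_eq, hm0.modeEnergy_eq_iff, hmin 0 h0]
          · rintro rfl
            exact ht rfl
    refine ⟨⟨(hbelow 0 h0).1, fun ψ hψ => ((hbelow 0 h0).2 ψ hψ).2.1⟩, hbelow, ?_, ?_, ?_⟩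
    · intro h hh
      have hm := isMinimal_halfFilling hn hpos hJ hh.le
      have hm0 := isMinimal_halfFilling hn hpos hJ h0.le
      obtain ⟨q, hq, hq', hsign⟩ := exists_zero_mode hn hpos hJ hh
      have hmin' := hm.iff_eq_or_eq_update hq hq'
      -- the second minimal configuration has the mode of energy zero flipped
      set t₁ := Function.update (halfFilling n) q (1 - halfFilling n q) with ht₁
      have hspin : modeEnergy 1 t₁ = -2 * Real.sign h := by
        rw [ht₁, modeEnergy_one_update, modeEnergy_one_halfFilling hn, hsign]
        ring
      have hsne : -2 * Real.sign h ≠ 0 := by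
        have : h ≠ 0 := by rintro rfl; rw [abs_zero] at hh; exact hc.ne hh
        simpa [Real.sign_eq_zero_iff] using this
      have hne : halfFilling n ≠ t₁ := by
        intro heq
        rw [← heq, modeEnergy_one_halfFilling hn] at hspin
        exact hsne hspin.symm
      have hφ : HasSpinZ (b t₁) (-2 * Real.sign h) := by
        rw [HasSpinZ, hbS, hspin]
      refine ⟨?_, fun ψ hψ => ?_, b t₁, hbgs J h t₁ ((hmin' t₁).2 (Or.inr rfl)), hφ,
        hφ.concurrence_eq_zero hsne⟩
      · rw [← Finset.card_pair hne]
        exact hdeg J h _ _ hm fun t => by rw [Finset.mem_insert, Finset.mem_singleton, hmin']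
      · rw [hgs J 0 _ ψ hm0] at hψ
        rw [hgs J h _ ψ hm]
        refine ⟨hψ.1, fun t ht => hψ.2 t fun ht' => ht ?_⟩
        rw [(hmin 0 h0 t).1 ht']
        exact hm
    · intro h hh
      refine ⟨?_, fun s ψ hs _ hψ => hψ.concurrence_eq_zero hs⟩
      obtain ⟨t, ht, hne⟩ := exists_isMinimal_spin_ne_zero hn hpos hJ hh
      exact ⟨_, hne, b t, hbgs J h t ht, hbS t⟩
    · intro h hh ψ hψ
      obtain ⟨t₀, ht₀, -⟩ := exists_isMinimal_spin_ne_zero hn hpos hJ hh.le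
      rw [hgs J h t₀ ψ ht₀] at hψ
      have hneg : ∀ t, inner ℂ (b t) ψ ≠ 0 → h * modeEnergy 1 t < 0 := fun t ht =>
        IsMinimal.mul_modeEnergy_one_neg hn hpos hJ hh (not_not.1 fun h' => ht (hψ.2 t h'))
      refine ⟨concurrence_eq_zero_of_sign hbS hneg, fun h0 => ?_⟩
      have hzero : ψ = 0 := by
        rw [← b.sum_repr' ψ]
        refine Finset.sum_eq_zero fun t _ => ?_
        by_cases ht : inner ℂ (b t) ψ = 0
        · rw [ht, zero_smul]
        · have := hneg t ht
          rw [inner_eigenbasis_eq_zero hbS h0 fun h' => by simp [h'] at this, zero_smul]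
      rw [hzero, norm_zero] at hψ
      exact zero_ne_one hψ.1
  · rw [partitionFunction_eq_sum (hbH J h), sum_exp_modeEnergy,
      prod_modeField J h fun x => Real.cosh (β * x)]
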